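/- A motif $M$ is a finite simple graph, considered up to isomorphism, with $v(M)$ vertices, $e(M)$ edges and $\mathrm{aut}(M)$ automorphisms. Let $n\ge 1$ be an integer, $0<p\le \tfrac12$ and $0<\rho\le 1$. Let $\mathcal P_1$ be the law of the correlated Erdős–Rényi pair $(G_1,G_2)\sim\mathcal G(n,p,\rho)$ on the vertex set $[n]$: a latent bijection $\pi$ of $[n]$ is uniformly random and, given $\pi$, the pairs $(\mathbf 1\{uv\in E(G_1)\},\mathbf 1\{\pi(u)\pi(v)\in E(G_2)\})$ are independent over the unordered pairs $uv$, each with both marginals Bernoulli($p$) and correlation coefficient $\rho$. For a graph $G$ on $[n]$ and a motif $M$ put $$\mathrm{inj}(M,\bar G)=\sum_{\varphi:V(M)\to[n]\ \text{injective}}\ \prod_{uv\in E(M)}\bigl(\mathbf 1\{\varphi(u)\varphi(v)\in E(G)\}-p\bigr).$$ For a finite family $\mathcal M$ of pairwise non-isomorphic motifs let $$\mathcal T_{\mathcal M}=\sum_{M\in\mathcal M}\omega_M\,\mathrm{inj}(M,\bar G_1)\,\mathrm{inj}(M,\bar G_2),\qquad \omega_M=\frac{\rho^{e(M)}\,(n-v(M))!}{n!\,(p(1-p))^{e(M)}\,\mathrm{aut}(M)}$$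 (motifs with $v(M)>n$ contribute $0$). Let $C\in\mathbb R$ and $\epsilon_0>0$, and suppose that $\mathcal M$ is $C$-admissible with constant $\epsilon_0$, that is: (1) every $M\in\mathcal M$ is connected; (2) $\max(v(M),e(M))\le C$ for every $M\in\mathcal M$; (3) $\sum_{M\in\mathcal M}\rho^{2e(M)}\ge 400$; (4) $n^{v(M')}p^{e(M')}\ge n^{\epsilon_0}$ for every $M\in\mathcal M$ and every subgraph $M'\subseteq M$ with at least one vertex. If $\tau=\tfrac12\,\mathbb E_{\mathcal P_1}[\mathcal T_{\mathcal M}]$, then, with $\kappa=\exp\bigl(\tfrac{C^2}{n-2C+1}\bigr)$ (and $\kappa=1$ if $n-2C+1=0$), $$\mathcal P_1(\mathcal T_{\mathcal M}<\tau)\ \le\ 4\left(3\,n^{-\epsilon_0/2}(4C)^{8C}\rho^{-2C}+\frac{\kappa+1}{\sum_{M\in\mathcal M}\rho^{2e(M)}}+\kappa-1\right).$$ No growth condition on $C$ relative to $n$ is needed: the bound holds for every $n\ge1$, hence along every sequence of admissible families with $C=o\bigl(\log n/\max(\log\log n,-\log\rho)\bigr)$. -/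

import Mathlib

namespace MotifCount

open MeasureTheory
open scoped ENNReal

/-- A motif: a finite simple graph, given on the vertex set `Fin v`. -/
structure Motif where
  /-- the number of vertices `v(M)` -/
  v : ℕ
  /-- the graph itself -/
  graph : SimpleGraph (Fin v)

/-- The number of edges `e(M)`. -/
noncomputable def Motif.e (M : Motif) : ℕ := M.graph.edgeSet.ncard

/-- The number of automorphisms `aut(M)`. -/
noncomputable def Motif.aut (M : Motif) : ℕ := Nat.card (M.graph ≃g M.graph)

/-- Motifs are considered up to isomorphism: a (finite) motif family has at most one
representative of each isomorphism class. -/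
def IsMotifFamily (𝓜 : Finset Motif) : Prop :=
  ∀ M ∈ 𝓜, ∀ N ∈ 𝓜, Nonempty (M.graph ≃g N.graph) → M = N

/-- The signal score `∑_{M ∈ 𝓜} ρ^{2 e(M)}`. -/
noncomputable def signalScore (ρ : ℝ) (𝓜 : Finset Motif) : ℝ :=
  ∑ M ∈ 𝓜, ρ ^ (2 * M.e)

/-- `C`-admissibility at a given `n`, with exponent `ε₀`. No growth condition on `C` as `n → ∞`
is imposed, so that every admissible sequence of families satisfies this at each of its terms. -/
structure IsAdmissible (n : ℕ) (p ρ C ε₀ : ℝ) (𝓜 : Finset Motif) : Prop where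
  connected : ∀ M ∈ 𝓜, M.graph.Connected
  size_le : ∀ M ∈ 𝓜, max (M.v : ℝ) (M.e : ℝ) ≤ C
  signal : 400 ≤ signalScore ρ 𝓜
  eps_pos : 0 < ε₀
  subgraph : ∀ M ∈ 𝓜, ∀ M' : M.graph.Subgraph, M'.verts.Nonempty →
    (n : ℝ) ^ ε₀ ≤ (n : ℝ) ^ M'.verts.ncard * p ^ M'.edgeSet.ncard

/-- The weight of the motif `M` in a weighted graph on `V` with edge weights `β`, along the map
`f : V(M) → V`, that is, `hom_f(M, β) = ∏_{uv ∈ E(M)} β_{f(u)f(v)}`. -/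
noncomputable def homWeight {V : Type*} (M : Motif) (β : Sym2 V → ℝ) (f : Fin M.v → V) : ℝ :=
  ∏ e ∈ M.graph.edgeSet.toFinite.toFinset, β (e.map f)

/-- `inj(M, β)`: the sum of `hom_f(M, β)` over all injective `f : V(M) → V`. -/
noncomputable def injCount {V : Type*} [Fintype V] [DecidableEq V] (M : Motif)
    (β : Sym2 V → ℝ) : ℝ :=
  ∑ f : Fin M.v ↪ V, homWeight M β f

open Classical in
/-- The centred edge weights `1{uv ∈ E(G)} - p`. -/
noncomputable def centered {V : Type*} (p : ℝ) (G : SimpleGraph V) (e : Sym2 V) : ℝ :=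
  (if e ∈ G.edgeSet then 1 else 0) - p

/-- The weight `ω_M = ρ^{e(M)} (n - v(M))! / (n! (p(1-p))^{e(M)} aut(M))`. If `v(M) > n` then
its value is irrelevant, since there are no injections from `V(M)`. -/
noncomputable def weight (n : ℕ) (p ρ : ℝ) (M : Motif) : ℝ :=
  ρ ^ M.e * (Nat.factorial (n - M.v) : ℝ) / ((Nat.factorial n : ℝ) * (p * (1 - p)) ^ M.e * (M.aut : ℝ))

/-- The motif counting statistic
`T_𝓜(G₁, G₂) = ∑_{M ∈ 𝓜} ω_M inj(M, Ḡ₁) inj(M, Ḡ₂)`. -/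
noncomputable def statistic (n : ℕ) (p ρ : ℝ) (𝓜 : Finset Motif)
    (G : SimpleGraph (Fin n) × SimpleGraph (Fin n)) : ℝ :=
  ∑ M ∈ 𝓜, weight n p ρ M * injCount M (centered p G.1) * injCount M (centered p G.2)

/-- The law on `{0,1}²` with both marginals Bernoulli(`p`) and correlation coefficient `ρ`. -/
noncomputable def corrBernoulli (p ρ : ℝ) : Measure (Bool × Bool) :=
  ENNReal.ofReal (p ^ 2 + ρ * (p * (1 - p))) • Measure.dirac (true, true)
    + ENNReal.ofReal ((1 - ρ) * (p * (1 - p))) • Measure.dirac (true, false)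
    + ENNReal.ofReal ((1 - ρ) * (p * (1 - p))) • Measure.dirac (false, true)
    + ENNReal.ofReal ((1 - p) ^ 2 + ρ * (p * (1 - p))) • Measure.dirac (false, false)

/-- The pair of graphs determined by a bijection `π` and a pair of bits `x e` for each vertex pair
`e`: the edge `uv` is in `G₁` iff the first bit of `x (uv)` is set, and `π(u)π(v)` is in `G₂`
iff the second bit of `x (uv)` is set. Loops are discarded. -/
def graphPair {n : ℕ} (π : Equiv.Perm (Fin n)) (x : Sym2 (Fin n) → Bool × Bool) :
    SimpleGraph (Fin n) × SimpleGraph (Fin n) :=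
  (SimpleGraph.fromEdgeSet {e | (x e).1 = true},
   SimpleGraph.fromEdgeSet {e | (x (e.map π.symm)).2 = true})

/-- The correlated Erdős–Rényi law conditionally on the latent bijection `π`: the pairs of
indicators of `uv ∈ E(G₁)`, `π(u)π(v) ∈ E(G₂)` are independent over the vertex pairs `uv`, each
with law `corrBernoulli p ρ`. -/
noncomputable def corrERGiven (n : ℕ) (p ρ : ℝ) (π : Equiv.Perm (Fin n)) :
    Measure (SimpleGraph (Fin n) × SimpleGraph (Fin n)) :=
  (Measure.pi fun _ : Sym2 (Fin n) => corrBernoulli p ρ).map (graphPair π)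

/-- The law of the correlated Erdős–Rényi graphs `𝒢(n, p, ρ)`: the latent bijection is uniform. -/
noncomputable def corrER (n : ℕ) (p ρ : ℝ) :
    Measure (SimpleGraph (Fin n) × SimpleGraph (Fin n)) :=
  (Nat.factorial n : ℝ≥0∞)⁻¹ • ∑ π : Equiv.Perm (Fin n), corrERGiven n p ρ π

end MotifCount

/-! The proof is Chebyshev's inequality with an explicit variance bound. Embedding counts do not
change when a graph is relabelled, so the latent bijection can be undone (`statistic_graphPair`),
and the statistic has the law of `bitStatistic`, a function of independent correlated pairs of bits.
Write `S` for the signal score. The weights are normalised so that each motif contributes at least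
`ρ ^ (2 * e(M))` to the mean. Hence the mean is at least `S`
(`signalScore_le_integral_bitStatistic`), and `τ ≥ S / 2`.

The second moment is a sum over pairs `M`, `N` and over four copies, one of each motif in each
graph. The expectation factorises over vertex pairs and vanishes unless every edge lies in at least
two of the four copies. There are two cases (`edgeMoment_copies_le`).

If no vertex lies in three copies, connectivity forces the copies to coincide in pairs
(`copies_eq_in_pairs`). Matching `M` with `M` and `N` with `N` contributes at most `S ^ 2`, which
the squared mean absorbs. The other two matchings force `M` and `N` to be isomorphic, hence equal,
and contribute at most `2 * S` in total.

If some vertex lies in three copies, the triple overlaps are subgraphs of copies, and the subgraph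
condition gains a factor `n ^ (-ε₀ / 2)` (`union_weight_mul_le`). Weighting each configuration by
`n⁻¹` to the size of its vertex union makes the number of configurations harmless
(`sum_pow_card_union_four_copyVerts_le`).

Together these give variance at most `2 * S + L * S ^ 2`, where `L = n ^ (-ε₀ / 2) * (4 * C) ^ (8 *
C) * ρ ^ (-2 * C)`, and Chebyshev gives `4 * (L + 2 / S)`. This is below the stated bound as soon as
`κ ≥ 1`. When `C` is too large compared with `n` for the argument to run, `L` is so large that the
stated bound is at least `1`. -/

namespace MotifCount

open MeasureTheory ProbabilityTheory
open scoped ENNReal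

/-! ### Copies of a motif as edge sets -/

section Copies

variable {V : Type*}

/-- The edges of the copy of `M` along the embedding `f`. -/
noncomputable def copyEdges (M : Motif) (f : Fin M.v ↪ V) : Finset (Sym2 V) :=
  M.graph.edgeSet.toFinite.toFinset.map f.sym2Map

lemma homWeight_eq_prod_copyEdges (M : Motif) (β : Sym2 V → ℝ) (f : Fin M.v ↪ V) :
    homWeight M β f = ∏ e ∈ copyEdges M f, β e := by
  simp [homWeight, copyEdges, Finset.prod_map]

lemma mem_copyEdges {M : Motif} {f : Fin M.v ↪ V} {e : Sym2 V} :
    e ∈ copyEdges M f ↔ ∃ a b, M.graph.Adj a b ∧ e = s(f a, f b) := by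
  simp only [copyEdges, Finset.mem_map, Set.Finite.mem_toFinset]
  constructor
  · rintro ⟨e', he', rfl⟩
    induction e' with | _ a b => exact ⟨a, b, he', rfl⟩
  · rintro ⟨a, b, h, rfl⟩
    exact ⟨s(a, b), h, rfl⟩

lemma mk_mem_copyEdges {M : Motif} {f : Fin M.v ↪ V} {a b : Fin M.v} :
    s(f a, f b) ∈ copyEdges M f ↔ M.graph.Adj a b := by
  rw [mem_copyEdges]
  constructor
  · rintro ⟨a', b', h, he⟩
    rw [Sym2.eq_iff] at he
    rcases he with ⟨h1, h2⟩ | ⟨h1, h2⟩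
    · rwa [f.injective h1, f.injective h2]
    · rw [f.injective h1, f.injective h2]; exact h.symm
  · exact fun h => ⟨a, b, h, rfl⟩

lemma not_isDiag_of_mem_copyEdges {M : Motif} {f : Fin M.v ↪ V} {e : Sym2 V}
    (he : e ∈ copyEdges M f) : ¬ e.IsDiag := by
  obtain ⟨a, b, h, rfl⟩ := mem_copyEdges.1 he
  simpa using h.ne

lemma card_copyEdges (M : Motif) (f : Fin M.v ↪ V) : (copyEdges M f).card = M.e := by
  rw [copyEdges, Finset.card_map, Motif.e, Set.ncard_eq_toFinset_card _ (Set.toFinite _)]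

variable [Fintype V] [DecidableEq V]

lemma injCount_congr {M : Motif} {β β' : Sym2 V → ℝ} (h : ∀ e, ¬ e.IsDiag → β e = β' e) :
    injCount M β = injCount M β' := by
  refine Finset.sum_congr rfl fun f _ => ?_
  rw [homWeight_eq_prod_copyEdges, homWeight_eq_prod_copyEdges]
  exact Finset.prod_congr rfl fun e he => h e (not_isDiag_of_mem_copyEdges he)

lemma injCount_comp_perm (M : Motif) (β : Sym2 V → ℝ) (π : Equiv.Perm V) :
    injCount M (fun e => β (e.map π)) = injCount M β := by
  refine Fintype.sum_equiv (Equiv.embeddingCongr (Equiv.refl _) π) _ _ fun f => ?_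
  refine Finset.prod_congr rfl fun e _ => ?_
  exact congrArg β (Sym2.map_map ..)

end Copies

/-! ### Undoing the latent bijection -/

/-- The centred value of a bit. -/
def bitVal (p : ℝ) (b : Bool) : ℝ := (if b then 1 else 0) - p

/-- The motif counting statistic in terms of the bits from which the correlated pair of graphs is
built, with the latent bijection undone. -/
noncomputable def bitStatistic (n : ℕ) (p ρ : ℝ) (𝓜 : Finset Motif)
    (x : Sym2 (Fin n) → Bool × Bool) : ℝ :=
  ∑ M ∈ 𝓜, weight n p ρ M * injCount M (fun e => bitVal p (x e).1) *
    injCount M (fun e => bitVal p (x e).2)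

/-- Composing embeddings with `π` merely permutes them, so the second count does not see the
relabelling. Copies of motifs contain no loops, so the bits at diagonal pairs are never read. -/
lemma statistic_graphPair (n : ℕ) (p ρ : ℝ) (𝓜 : Finset Motif) (π : Equiv.Perm (Fin n))
    (x : Sym2 (Fin n) → Bool × Bool) :
    statistic n p ρ 𝓜 (graphPair π x) = bitStatistic n p ρ 𝓜 x := by
  refine Finset.sum_congr rfl fun M _ => ?_
  have h1 : injCount M (centered p (graphPair π x).1) = injCount M fun e => bitVal p (x e).1 := by
    refine injCount_congr fun e he => ?_
    simp only [centered, graphPair, bitVal, SimpleGraph.edgeSet_fromEdgeSet, Set.mem_sdiff,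
      Set.mem_ofPred_eq, Sym2.mem_diagSet, he, not_false_eq_true, and_true]
  have h2 : injCount M (centered p (graphPair π x).2) = injCount M fun e => bitVal p (x e).2 := by
    rw [← injCount_comp_perm M (fun e => bitVal p (x e).2) π.symm]
    refine injCount_congr fun e he => ?_
    simp only [centered, graphPair, bitVal, SimpleGraph.edgeSet_fromEdgeSet, Set.mem_sdiff,
      Set.mem_ofPred_eq, Sym2.mem_diagSet, he, not_false_eq_true, and_true]
  rw [h1, h2]

lemma measurableSingletonClass_simpleGraph (n : ℕ) :
    MeasurableSingletonClass (SimpleGraph (Fin n)) := by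
  refine ⟨fun G => ⟨{G.Adj}, measurableSet_singleton _, ?_⟩⟩
  ext H
  exact SimpleGraph.adj_inj

/-! ### Mixed moments of one correlated pair of bits -/

section Bernoulli

variable {p ρ : ℝ}

lemma integral_corrBernoulli (hp0 : 0 < p) (hp : p ≤ 1 / 2) (hρ0 : 0 < ρ) (hρ : ρ ≤ 1)
    (g : Bool × Bool → ℝ) :
    ∫ z, g z ∂corrBernoulli p ρ = (p ^ 2 + ρ * (p * (1 - p))) * g (true, true)
      + ((1 - ρ) * (p * (1 - p))) * g (true, false) + ((1 - ρ) * (p * (1 - p))) * g (false, true)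
      + ((1 - p) ^ 2 + ρ * (p * (1 - p))) * g (false, false) := by
  have hq : 0 ≤ p * (1 - p) := by nlinarith
  have h1 : 0 ≤ p ^ 2 + ρ * (p * (1 - p)) := by positivity
  have h2 : 0 ≤ (1 - ρ) * (p * (1 - p)) := mul_nonneg (by linarith) hq
  have h3 : 0 ≤ (1 - p) ^ 2 + ρ * (p * (1 - p)) := by positivity
  have hi : ∀ (a : ℝ) (z : Bool × Bool),
      Integrable g (ENNReal.ofReal a • Measure.dirac z) := fun a z =>
    (integrable_dirac (by simp)).smul_measure ENNReal.ofReal_ne_top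
  rw [corrBernoulli, integral_add_measure (((hi _ _).add_measure (hi _ _)).add_measure (hi _ _))
    (hi _ _), integral_add_measure ((hi _ _).add_measure (hi _ _)) (hi _ _),
    integral_add_measure (hi _ _) (hi _ _)]
  simp only [integral_smul_measure, integral_dirac, smul_eq_mul, ENNReal.toReal_ofReal h1,
    ENNReal.toReal_ofReal h2, ENNReal.toReal_ofReal h3]

lemma isProbabilityMeasure_corrBernoulli (hp0 : 0 < p) (hp : p ≤ 1 / 2) (hρ0 : 0 < ρ)
    (hρ : ρ ≤ 1) : IsProbabilityMeasure (corrBernoulli p ρ) := by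
  have hq : 0 ≤ p * (1 - p) := by nlinarith
  have h1 : 0 ≤ p ^ 2 + ρ * (p * (1 - p)) := by positivity
  have h2 : 0 ≤ (1 - ρ) * (p * (1 - p)) := mul_nonneg (by linarith) hq
  have h3 : 0 ≤ (1 - p) ^ 2 + ρ * (p * (1 - p)) := by positivity
  refine ⟨?_⟩
  simp only [corrBernoulli, Measure.add_apply, Measure.smul_apply, measure_univ, smul_eq_mul,
    mul_one]
  rw [← ENNReal.ofReal_add h1 h2, ← ENNReal.ofReal_add (by positivity) h2,
    ← ENNReal.ofReal_add (by positivity) h3, ENNReal.ofReal_eq_one]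
  ring

/-- The mixed moments of a pair of centred correlated bits. -/
noncomputable def bitMoment (p ρ : ℝ) (a b : ℕ) : ℝ :=
  ∫ z, bitVal p z.1 ^ a * bitVal p z.2 ^ b ∂corrBernoulli p ρ

lemma bitMoment_eq (hp0 : 0 < p) (hp : p ≤ 1 / 2) (hρ0 : 0 < ρ) (hρ : ρ ≤ 1) (a b : ℕ) :
    bitMoment p ρ a b = (p ^ 2 + ρ * (p * (1 - p))) * ((1 - p) ^ a * (1 - p) ^ b)
      + ((1 - ρ) * (p * (1 - p))) * ((1 - p) ^ a * (-p) ^ b)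
      + ((1 - ρ) * (p * (1 - p))) * ((-p) ^ a * (1 - p) ^ b)
      + ((1 - p) ^ 2 + ρ * (p * (1 - p))) * ((-p) ^ a * (-p) ^ b) := by
  rw [bitMoment, integral_corrBernoulli hp0 hp hρ0 hρ]
  simp [bitVal]

lemma bitMoment_zero_zero (hp0 : 0 < p) (hp : p ≤ 1 / 2) (hρ0 : 0 < ρ) (hρ : ρ ≤ 1) :
    bitMoment p ρ 0 0 = 1 := by
  rw [bitMoment_eq hp0 hp hρ0 hρ]; ring

lemma bitMoment_one_zero (hp0 : 0 < p) (hp : p ≤ 1 / 2) (hρ0 : 0 < ρ) (hρ : ρ ≤ 1) :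
    bitMoment p ρ 1 0 = 0 := by
  rw [bitMoment_eq hp0 hp hρ0 hρ]; ring

lemma bitMoment_zero_one (hp0 : 0 < p) (hp : p ≤ 1 / 2) (hρ0 : 0 < ρ) (hρ : ρ ≤ 1) :
    bitMoment p ρ 0 1 = 0 := by
  rw [bitMoment_eq hp0 hp hρ0 hρ]; ring

lemma bitMoment_one_one (hp0 : 0 < p) (hp : p ≤ 1 / 2) (hρ0 : 0 < ρ) (hρ : ρ ≤ 1) :
    bitMoment p ρ 1 1 = ρ * (p * (1 - p)) := by
  rw [bitMoment_eq hp0 hp hρ0 hρ]; ring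

lemma bitMoment_two_zero (hp0 : 0 < p) (hp : p ≤ 1 / 2) (hρ0 : 0 < ρ) (hρ : ρ ≤ 1) :
    bitMoment p ρ 2 0 = p * (1 - p) := by
  rw [bitMoment_eq hp0 hp hρ0 hρ]; ring

lemma bitMoment_zero_two (hp0 : 0 < p) (hp : p ≤ 1 / 2) (hρ0 : 0 < ρ) (hρ : ρ ≤ 1) :
    bitMoment p ρ 0 2 = p * (1 - p) := by
  rw [bitMoment_eq hp0 hp hρ0 hρ]; ring

/-- The moments of total order three carry the factor `1 - 2 * p`; this is where `p ≤ 1 / 2` ensures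
nonnegativity. -/
lemma bitMoment_mem_Icc (hp0 : 0 < p) (hp : p ≤ 1 / 2) (hρ0 : 0 < ρ) (hρ : ρ ≤ 1)
    {a b : ℕ} (ha : a ≤ 2) (hb : b ≤ 2) (hab : 0 < a + b) :
    bitMoment p ρ a b ∈ Set.Icc 0 (p * (1 - p)) := by
  have hq : 0 ≤ p * (1 - p) := by nlinarith
  have h21 : bitMoment p ρ 2 1 = (1 - 2 * p) * ρ * (p * (1 - p)) := by
    rw [bitMoment_eq hp0 hp hρ0 hρ]; ring
  have h12 : bitMoment p ρ 1 2 = (1 - 2 * p) * ρ * (p * (1 - p)) := by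
    rw [bitMoment_eq hp0 hp hρ0 hρ]; ring
  have h22 : bitMoment p ρ 2 2 = (p * (1 - p) + (1 - 2 * p) ^ 2 * ρ) * (p * (1 - p)) := by
    rw [bitMoment_eq hp0 hp hρ0 hρ]; ring
  have hc : 0 ≤ (1 - 2 * p) * ρ := mul_nonneg (by linarith) hρ0.le
  have hc' : (1 - 2 * p) * ρ ≤ 1 := mul_le_one₀ (by linarith) hρ0.le hρ
  have hd : p * (1 - p) + (1 - 2 * p) ^ 2 * ρ ≤ 1 := by
    have : (1 - 2 * p) ^ 2 * ρ ≤ (1 - 2 * p) ^ 2 := mul_le_of_le_one_right (sq_nonneg _) hρ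
    nlinarith
  have hd' : 0 ≤ p * (1 - p) + (1 - 2 * p) ^ 2 * ρ := by positivity
  rw [Set.mem_Icc]
  interval_cases a <;> interval_cases b
  · simp at hab
  · rw [bitMoment_zero_one hp0 hp hρ0 hρ]; exact ⟨le_rfl, hq⟩
  · rw [bitMoment_zero_two hp0 hp hρ0 hρ]; exact ⟨hq, le_rfl⟩
  · rw [bitMoment_one_zero hp0 hp hρ0 hρ]; exact ⟨le_rfl, hq⟩
  · rw [bitMoment_one_one hp0 hp hρ0 hρ]
    exact ⟨mul_nonneg hρ0.le hq, mul_le_of_le_one_left hq hρ⟩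
  · rw [h12]; exact ⟨mul_nonneg hc hq, mul_le_of_le_one_left hq hc'⟩
  · rw [bitMoment_two_zero hp0 hp hρ0 hρ]; exact ⟨hq, le_rfl⟩
  · rw [h21]; exact ⟨mul_nonneg hc hq, mul_le_of_le_one_left hq hc'⟩
  · rw [h22]; exact ⟨mul_nonneg hd' hq, mul_le_of_le_one_left hq hd⟩

end Bernoulli

/-! ### Transfer to independent bits -/

/-- The law of the bits from which the correlated pair of graphs is built. -/
noncomputable def bitLaw (n : ℕ) (p ρ : ℝ) : Measure (Sym2 (Fin n) → Bool × Bool) :=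
  Measure.pi fun _ : Sym2 (Fin n) => corrBernoulli p ρ

/-- All `n!` conditional laws given `π` push forward to the same measure, so averaging over `π` does
nothing. -/
lemma map_statistic_corrER (n : ℕ) (p ρ : ℝ) (𝓜 : Finset Motif) :
    (corrER n p ρ).map (statistic n p ρ 𝓜) = (bitLaw n p ρ).map (bitStatistic n p ρ 𝓜) := by
  have := measurableSingletonClass_simpleGraph n
  have hm : Measurable (statistic n p ρ 𝓜) := measurable_of_countable _
  have hg : ∀ π : Equiv.Perm (Fin n), Measurable (graphPair π) := fun π => measurable_of_countable _
  rw [corrER, Measure.map_smul, Measure.map_finset_sum hm.aemeasurable]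
  have : ∀ π : Equiv.Perm (Fin n), (corrERGiven n p ρ π).map (statistic n p ρ 𝓜)
      = (bitLaw n p ρ).map (bitStatistic n p ρ 𝓜) := by
    intro π
    rw [corrERGiven, Measure.map_map hm (hg π)]
    congr 1
    ext x
    exact statistic_graphPair n p ρ 𝓜 π x
  simp only [this, Finset.sum_const, Finset.card_univ, Fintype.card_perm, Fintype.card_fin]
  rw [← Nat.cast_smul_eq_nsmul ℝ≥0∞, smul_smul, ENNReal.inv_mul_cancel, one_smul]
  · exact_mod_cast Nat.factorial_ne_zero n
  · exact ENNReal.natCast_ne_top _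

lemma corrER_real_statistic_lt (n : ℕ) (p ρ : ℝ) (𝓜 : Finset Motif) (τ : ℝ) :
    (corrER n p ρ).real {G | statistic n p ρ 𝓜 G < τ}
      = (bitLaw n p ρ).real {x | bitStatistic n p ρ 𝓜 x < τ} := by
  have := measurableSingletonClass_simpleGraph n
  have hm : Measurable (statistic n p ρ 𝓜) := measurable_of_countable _
  have hb : Measurable (bitStatistic n p ρ 𝓜) := measurable_of_countable _
  have h1 := map_measureReal_apply (μ := corrER n p ρ) hm (measurableSet_Iio (a := τ))
  have h2 := map_measureReal_apply (μ := bitLaw n p ρ) hb (measurableSet_Iio (a := τ))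
  rw [map_statistic_corrER, h2] at h1
  exact h1.symm

lemma integral_statistic_corrER (n : ℕ) (p ρ : ℝ) (𝓜 : Finset Motif) :
    ∫ G, statistic n p ρ 𝓜 G ∂corrER n p ρ = ∫ x, bitStatistic n p ρ 𝓜 x ∂bitLaw n p ρ := by
  have := measurableSingletonClass_simpleGraph n
  have hm : Measurable (statistic n p ρ 𝓜) := measurable_of_countable _
  have hb : Measurable (bitStatistic n p ρ 𝓜) := measurable_of_countable _
  have h1 := integral_map (μ := corrER n p ρ) hm.aemeasurable
    (f := id) measurable_id.aestronglyMeasurable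
  have h2 := integral_map (μ := bitLaw n p ρ) hb.aemeasurable
    (f := id) measurable_id.aestronglyMeasurable
  rw [map_statistic_corrER, h2] at h1
  exact h1.symm

/-! ### Factorisation of expectations over vertex pairs -/

section Expectation

variable {n : ℕ} {p ρ : ℝ}

/-- The number of the two sets `A`, `B` that contain `e`. -/
def multiplicity {α : Type*} [DecidableEq α] (A B : Finset α) (e : α) : ℕ :=
  (if e ∈ A then 1 else 0) + (if e ∈ B then 1 else 0)

lemma prod_mul_prod_eq_prod_pow_multiplicity {α : Type*} [Fintype α] [DecidableEq α]
    (A B : Finset α) (f : α → ℝ) :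
    (∏ e ∈ A, f e) * ∏ e ∈ B, f e = ∏ e, f e ^ multiplicity A B e := by
  simp only [multiplicity, pow_add, Finset.prod_mul_distrib, pow_ite, pow_one, pow_zero,
    Finset.prod_ite_mem, Finset.univ_inter]

lemma integral_bitLaw_prod (hp0 : 0 < p) (hp : p ≤ 1 / 2) (hρ0 : 0 < ρ) (hρ : ρ ≤ 1)
    (A₁ A₂ B₁ B₂ : Finset (Sym2 (Fin n))) :
    ∫ x, (∏ e ∈ A₁, bitVal p (x e).1) * (∏ e ∈ A₂, bitVal p (x e).1) *
      ((∏ e ∈ B₁, bitVal p (x e).2) * ∏ e ∈ B₂, bitVal p (x e).2) ∂bitLaw n p ρ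
      = ∏ e, bitMoment p ρ (multiplicity A₁ A₂ e) (multiplicity B₁ B₂ e) := by
  have := isProbabilityMeasure_corrBernoulli hp0 hp hρ0 hρ
  simp only [prod_mul_prod_eq_prod_pow_multiplicity, ← Finset.prod_mul_distrib]
  exact integral_fintype_prod_eq_prod (μ := fun _ : Sym2 (Fin n) => corrBernoulli p ρ)
    fun (e : Sym2 (Fin n)) (z : Bool × Bool) =>
      bitVal p z.1 ^ multiplicity A₁ A₂ e * bitVal p z.2 ^ multiplicity B₁ B₂ e

end Expectation

/-! ### Connected copies and automorphisms -/

section ConnectedCopy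

variable {V : Type*}

/-- The pair `(W, E)` is a nonempty connected graph without isolated vertices. -/
structure IsConnectedCopy (W : Finset V) (E : Finset (Sym2 V)) : Prop where
  nonempty : W.Nonempty
  mem_of_edge : ∀ {a b}, s(a, b) ∈ E → a ∈ W
  exists_edge : ∀ {a}, a ∈ W → ∃ b, s(a, b) ∈ E
  induct : ∀ (P : V → Prop) {a}, a ∈ W → P a → (∀ b c, s(b, c) ∈ E → P b → P c) → ∀ w ∈ W, P w

/-- The vertices of the copy of `M` along the embedding `f`. -/
def copyVerts (M : Motif) (f : Fin M.v ↪ V) : Finset V := Finset.univ.map f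

lemma mem_copyVerts {M : Motif} {f : Fin M.v ↪ V} {u : V} :
    u ∈ copyVerts M f ↔ ∃ a, f a = u := by
  simp [copyVerts]

lemma card_copyVerts (M : Motif) (f : Fin M.v ↪ V) : (copyVerts M f).card = M.v := by
  simp [copyVerts]

lemma Motif.exists_adj {M : Motif} (hc : M.graph.Connected) (he : M.e ≠ 0) (a : Fin M.v) :
    ∃ b, M.graph.Adj a b := by
  have hne : M.graph.edgeSet.Nonempty := by
    rw [Set.nonempty_iff_ne_empty]
    rintro h
    exact he (by rw [Motif.e, h, Set.ncard_empty])
  obtain ⟨e, he⟩ := hne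
  induction e with | _ c d =>
  have hcd : M.graph.Adj c d := he
  have : Nontrivial (Fin M.v) := ⟨c, d, hcd.ne⟩
  exact hc.preconnected.exists_adj_of_nontrivial a

lemma isConnectedCopy_copy {M : Motif} (hc : M.graph.Connected) (he : M.e ≠ 0)
    (f : Fin M.v ↪ V) : IsConnectedCopy (copyVerts M f) (copyEdges M f) where
  nonempty := by
    obtain ⟨a⟩ := hc.nonempty
    exact ⟨f a, mem_copyVerts.2 ⟨a, rfl⟩⟩
  mem_of_edge {u w} h := by
    obtain ⟨a, b, -, hab⟩ := mem_copyEdges.1 h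
    rw [Sym2.eq_iff] at hab
    rcases hab with ⟨h1, -⟩ | ⟨h1, -⟩
    · exact mem_copyVerts.2 ⟨a, h1.symm⟩
    · exact mem_copyVerts.2 ⟨b, h1.symm⟩
  exists_edge {u} h := by
    obtain ⟨a, rfl⟩ := mem_copyVerts.1 h
    obtain ⟨b, hb⟩ := Motif.exists_adj hc he a
    exact ⟨f b, mk_mem_copyEdges.2 hb⟩
  induct P u hu hP hstep w hw := by
    obtain ⟨a, rfl⟩ := mem_copyVerts.1 hu
    obtain ⟨b, rfl⟩ := mem_copyVerts.1 hw
    obtain ⟨walk⟩ := hc.preconnected a b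
    clear hu hw
    induction walk with
    | nil => exact hP
    | cons h _ ih => exact ih (hstep _ _ (mk_mem_copyEdges.2 h) hP)

/-- Without isolated vertices the edge set determines the vertex set, so `f` and `g` have the same
range and `g⁻¹ ∘ f` is a bijection. Adjacency on both sides is read off from the common edge set. -/
lemma exists_iso_of_copyEdges_eq {M N : Motif} (hM : M.graph.Connected) (hMe : M.e ≠ 0)
    (hN : N.graph.Connected) (hNe : N.e ≠ 0) {f : Fin M.v ↪ V} {g : Fin N.v ↪ V}
    (h : copyEdges M f = copyEdges N g) : ∃ σ : M.graph ≃g N.graph, ∀ a, g (σ a) = f a := by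
  have hf := isConnectedCopy_copy hM hMe f
  have hg := isConnectedCopy_copy hN hNe g
  have hrange : Set.range f = Set.range g := by
    ext u
    constructor
    · intro hu
      obtain ⟨w, hw⟩ := hf.exists_edge (mem_copyVerts.2 hu)
      exact mem_copyVerts.1 (hg.mem_of_edge (h ▸ hw))
    · intro hu
      obtain ⟨w, hw⟩ := hg.exists_edge (mem_copyVerts.2 hu)
      exact mem_copyVerts.1 (hf.mem_of_edge (h.symm ▸ hw))
  let e : Fin M.v ≃ Fin N.v := (Equiv.ofInjective f f.injective).trans
    ((Equiv.setCongr hrange).trans (Equiv.ofInjective g g.injective).symm)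
  have he : ∀ a, g (e a) = f a := fun a =>
    congrArg Subtype.val ((Equiv.ofInjective g g.injective).apply_symm_apply
      (Equiv.setCongr hrange (Equiv.ofInjective f f.injective a)))
  refine ⟨⟨e, fun {a b} => ?_⟩, he⟩
  rw [← mk_mem_copyEdges (f := g), he, he, ← h, mk_mem_copyEdges]

lemma copyEdges_comp_iso {M : Motif} (f : Fin M.v ↪ V) (σ : M.graph ≃g M.graph) :
    copyEdges M (σ.toEquiv.toEmbedding.trans f) = copyEdges M f := by
  ext e
  rw [mem_copyEdges, mem_copyEdges]
  constructor
  · rintro ⟨a, b, h, rfl⟩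
    exact ⟨σ a, σ b, σ.map_adj_iff.2 h, rfl⟩
  · rintro ⟨a, b, h, rfl⟩
    exact ⟨σ.symm a, σ.symm b, σ.symm.map_adj_iff.2 h, by simp⟩

instance instFiniteMotifAut (M : Motif) : Finite (M.graph ≃g M.graph) :=
  Finite.of_injective _ RelIso.toEquiv_injective

lemma Motif.aut_pos (M : Motif) : 0 < M.aut :=
  Nat.card_pos_iff.2 ⟨⟨SimpleGraph.Iso.refl⟩, inferInstance⟩

variable [Fintype V] [DecidableEq V]

/-- Distinct automorphisms reparametrise `f` to distinct embeddings with the same edges.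
Connectivity enters only in the reverse bound. -/
lemma aut_le_card_copyEdges_eq {M : Motif} (f : Fin M.v ↪ V) :
    M.aut ≤ (Finset.univ.filter fun g : Fin M.v ↪ V => copyEdges M f = copyEdges M g).card := by
  have := Fintype.ofFinite (M.graph ≃g M.graph)
  rw [Motif.aut, Nat.card_eq_fintype_card, ← Finset.card_univ]
  refine Finset.card_le_card_of_injOn (fun σ => σ.toEquiv.toEmbedding.trans f) (fun σ _ => ?_)
    fun σ _ σ' _ h => ?_
  · simp [copyEdges_comp_iso]
  · ext a
    exact congrArg Fin.val (f.injective (DFunLike.congr_fun h a))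

lemma card_copyEdges_eq_le_aut {M : Motif} (hM : M.graph.Connected) (hMe : M.e ≠ 0)
    (f : Fin M.v ↪ V) :
    (Finset.univ.filter fun g : Fin M.v ↪ V => copyEdges M f = copyEdges M g).card ≤ M.aut := by
  have := Fintype.ofFinite (M.graph ≃g M.graph)
  rw [Motif.aut, Nat.card_eq_fintype_card, ← Finset.card_univ]
  refine Finset.card_le_card_of_surjOn (fun σ => σ.toEquiv.toEmbedding.trans f) fun g hg => ?_
  simp only [Finset.coe_filter, Finset.mem_univ, true_and, Set.mem_ofPred_eq] at hg
  obtain ⟨σ, hσ⟩ := exists_iso_of_copyEdges_eq hM hMe hM hMe hg.symm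
  refine ⟨σ, by simp, ?_⟩
  ext a
  exact hσ a

end ConnectedCopy

/-! ### Four copies with no vertex in three of them -/

section Pairing

variable {V : Type*} {W : Fin 4 → Finset V} {E : Fin 4 → Finset (Sym2 V)}

/-- An edge of copy `i` is shared with some copy `j`. The next edge at a vertex common to `i` and
`j` is also shared with some copy, which must be `j` again, since otherwise that vertex lies in
three copies. By connectivity copy `i` sits inside copy `j`. Repeating this from `j` must lead back
to `i`, so the edge sets agree. -/
lemma exists_ne_copy_eq (hcopy : ∀ i, IsConnectedCopy (W i) (E i))
    (hcov : ∀ i, ∀ e ∈ E i, ∃ j, j ≠ i ∧ e ∈ E j)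
    (hthree : ∀ i j k, i ≠ j → i ≠ k → j ≠ k → ∀ u, u ∈ W i → u ∈ W j → u ∉ W k) (i : Fin 4) :
    ∃ j, j ≠ i ∧ E i = E j ∧ W i ⊆ W j := by
  have key : ∀ i, ∃ j, j ≠ i ∧ E i ⊆ E j ∧ W i ⊆ W j := by
    intro i
    obtain ⟨u, hu⟩ := (hcopy i).nonempty
    obtain ⟨w, hw⟩ := (hcopy i).exists_edge hu
    obtain ⟨j, hj, hwj⟩ := hcov i _ hw
    have hstep : ∀ b c, s(b, c) ∈ E i → b ∈ W j → s(b, c) ∈ E j := by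
      intro b c hbc hb
      obtain ⟨k, hk, hbk⟩ := hcov i _ hbc
      by_cases hjk : j = k
      · rwa [hjk]
      · exact absurd ((hcopy k).mem_of_edge hbk)
          (hthree i j k hj.symm hk.symm hjk b ((hcopy i).mem_of_edge hbc) hb)
    have hW : W i ⊆ W j := (hcopy i).induct (· ∈ W j) hu ((hcopy j).mem_of_edge hwj)
      fun b c hbc hb => (hcopy j).mem_of_edge (Sym2.eq_swap ▸ hstep b c hbc hb)
    refine ⟨j, hj, fun e he => ?_, hW⟩
    induction e with | _ b c => exact hstep b c he (hW ((hcopy i).mem_of_edge he))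
  obtain ⟨j, hj, hE, hW⟩ := key i
  obtain ⟨k, hk, hE', hW'⟩ := key j
  obtain ⟨u, hu⟩ := (hcopy i).nonempty
  have hki : k = i := by
    by_contra hne
    exact hthree i j k hj.symm (Ne.symm hne) hk.symm u hu (hW hu) (hW' (hW hu))
  subst hki
  exact ⟨j, hj, hE.antisymm hE', hW⟩

/-- The alternatives are the three perfect matchings of four copies. Different pairs are
edge-disjoint because an endpoint of a common edge would lie in three copies. -/
lemma copies_eq_in_pairs (hcopy : ∀ i, IsConnectedCopy (W i) (E i))
    (hcov : ∀ i, ∀ e ∈ E i, ∃ j, j ≠ i ∧ e ∈ E j)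
    (hthree : ∀ i j k, i ≠ j → i ≠ k → j ≠ k → ∀ u, u ∈ W i → u ∈ W j → u ∉ W k) :
    (E 0 = E 2 ∧ E 1 = E 3 ∧ Disjoint (E 0) (E 1)) ∨
    (E 0 = E 3 ∧ E 1 = E 2 ∧ Disjoint (E 0) (E 1)) ∨
    (E 0 = E 1 ∧ E 2 = E 3 ∧ Disjoint (E 0) (E 2)) := by
  have hdisj : ∀ i j k, i ≠ j → i ≠ k → j ≠ k → E i = E j → Disjoint (E i) (E k) := by
    intro i j k hij hik hjk h
    rw [Finset.disjoint_left]
    intro e hi hk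
    have hj := h ▸ hi
    induction e with | _ b c =>
    exact hthree i j k hij hik hjk b ((hcopy i).mem_of_edge hi) ((hcopy j).mem_of_edge hj)
      ((hcopy k).mem_of_edge hk)
  have hedge : ∀ i, (E i).Nonempty := fun i => by
    obtain ⟨u, hu⟩ := (hcopy i).nonempty
    obtain ⟨w, hw⟩ := (hcopy i).exists_edge hu
    exact ⟨_, hw⟩
  have hne : ∀ i j k, i ≠ j → i ≠ k → j ≠ k → E i = E j → E i ≠ E k := by
    intro i j k hij hik hjk h h'
    have := hdisj i j k hij hik hjk h
    rw [← h', disjoint_self] at this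
    exact (hedge i).ne_empty this
  obtain ⟨j, hj, h0, -⟩ := exists_ne_copy_eq hcopy hcov hthree 0
  fin_cases j
  · exact absurd rfl hj
  · obtain ⟨k, hk, h2, -⟩ := exists_ne_copy_eq hcopy hcov hthree 2
    right; right
    refine ⟨h0, ?_, hdisj 0 1 2 (by decide) (by decide) (by decide) h0⟩
    fin_cases k
    · exact absurd h2.symm (hne 0 1 2 (by decide) (by decide) (by decide) h0)
    · exact absurd (h0.trans h2.symm) (hne 0 1 2 (by decide) (by decide) (by decide) h0)
    · exact absurd rfl hk
    · exact h2
  · obtain ⟨k, hk, h1, -⟩ := exists_ne_copy_eq hcopy hcov hthree 1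
    left
    refine ⟨h0, ?_, hdisj 0 2 1 (by decide) (by decide) (by decide) h0⟩
    fin_cases k
    · exact absurd h1.symm (hne 0 2 1 (by decide) (by decide) (by decide) h0)
    · exact absurd rfl hk
    · exact absurd (h0.trans h1.symm) (hne 0 2 1 (by decide) (by decide) (by decide) h0)
    · exact h1
  · obtain ⟨k, hk, h1, -⟩ := exists_ne_copy_eq hcopy hcov hthree 1
    right; left
    refine ⟨h0, ?_, hdisj 0 3 1 (by decide) (by decide) (by decide) h0⟩
    fin_cases k
    · exact absurd h1.symm (hne 0 3 1 (by decide) (by decide) (by decide) h0)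
    · exact absurd rfl hk
    · exact h1
    · exact absurd (h0.trans h1.symm) (hne 0 3 1 (by decide) (by decide) (by decide) h0)

end Pairing

/-! ### Counting configurations by the size of their union -/

section Counting

/-- Each point has multiplicity 0, 2, 3 or 4. The two overlap terms count nothing for multiplicity
at most 2, exactly one of them counts a point of multiplicity 3, and both count a point of
multiplicity 4. -/
lemma sum_card_of_covered_twice {α : Type*} [Fintype α] [DecidableEq α] (S : Fin 4 → Finset α)
    (hcov : ∀ i, ∀ x ∈ S i, ∃ j, j ≠ i ∧ x ∈ S j) :
    (S 0).card + (S 1).card + (S 2).card + (S 3).card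
      = 2 * (S 0 ∪ S 1 ∪ S 2 ∪ S 3).card + (S 0 ∩ S 1 ∩ (S 2 ∪ S 3)).card
        + (S 2 ∩ S 3 ∩ (S 0 ∪ S 1)).card := by
  have hcard : ∀ s : Finset α, s.card = ∑ x, if x ∈ s then 1 else 0 := fun s => by simp
  simp only [hcard, Finset.mul_sum, ← Finset.sum_add_distrib]
  refine Finset.sum_congr rfl fun x _ => ?_
  have h0 := hcov 0 x
  have h1 := hcov 1 x
  have h2 := hcov 2 x
  have h3 := hcov 3 x
  simp only [Fin.exists_fin_succ, Finset.mem_union, Finset.mem_inter] at *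
  by_cases x0 : x ∈ S 0 <;> by_cases x1 : x ∈ S 1 <;> by_cases x2 : x ∈ S 2 <;>
    by_cases x3 : x ∈ S 3 <;> simp_all

/-- There are `W.card` choices of an old vertex, which cost nothing. The choices of a new vertex
each cost a factor `r`, and together they weigh at most one because `Fintype.card V * r ≤ 1`. -/
lemma sum_pow_card_insert_le {V : Type*} [Fintype V] [DecidableEq V] {r : ℝ} (hr : 0 ≤ r)
    (hrV : Fintype.card V * r ≤ 1) (W : Finset V) :
    ∑ a, r ^ (insert a W).card ≤ (W.card + 1) * r ^ W.card := by
  have hle : ∀ a, r ^ (insert a W).card ≤ (if a ∈ W then r ^ W.card else 0) + r * r ^ W.card := by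
    intro a
    by_cases ha : a ∈ W
    · rw [Finset.insert_eq_of_mem ha, if_pos ha]
      have : 0 ≤ r * r ^ W.card := by positivity
      linarith
    · rw [Finset.card_insert_of_notMem ha, if_neg ha, pow_succ, zero_add, mul_comm]
  refine (Finset.sum_le_sum fun a _ => hle a).trans ?_
  rw [Finset.sum_add_distrib, Finset.sum_ite_mem, Finset.univ_inter, Finset.sum_const,
    Finset.sum_const, Finset.card_univ, nsmul_eq_mul, nsmul_eq_mul, ← mul_assoc, add_mul]
  gcongr

lemma sum_pow_card_union_image_le {V : Type*} [Fintype V] [DecidableEq V] {r : ℝ} (hr : 0 ≤ r)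
    (hrV : Fintype.card V * r ≤ 1) {D : ℕ} (k : ℕ) (W : Finset V) (hD : W.card + k ≤ D) :
    ∑ f : Fin k → V, r ^ (W ∪ Finset.univ.image f).card ≤ (D : ℝ) ^ k * r ^ W.card := by
  induction k generalizing W with
  | zero => simp
  | succ k ih =>
    rw [← (Fin.consEquiv fun _ => V).sum_comp, Fintype.sum_prod_type]
    have himage : ∀ (a : V) (g : Fin k → V),
        W ∪ Finset.univ.image (Fin.cons a g : Fin (k + 1) → V)
          = insert a W ∪ Finset.univ.image g := by
      intro a g
      ext u
      simp only [Finset.mem_union, Finset.mem_image, Finset.mem_univ, true_and, Fin.exists_fin_succ,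
        Fin.cons_zero, Fin.cons_succ, Finset.mem_insert]
      tauto
    calc ∑ a, ∑ g : Fin k → V, r ^ (W ∪ Finset.univ.image (Fin.cons a g : Fin (k + 1) → V)).card
        ≤ ∑ a, (D : ℝ) ^ k * r ^ (insert a W).card := by
          refine Finset.sum_le_sum fun a _ => ?_
          simp only [himage]
          exact ih _ (by have := Finset.card_insert_le a W; omega)
      _ ≤ (D : ℝ) ^ k * ((W.card + 1) * r ^ W.card) := by
          rw [← Finset.mul_sum]
          gcongr
          exact sum_pow_card_insert_le hr hrV W
      _ ≤ (D : ℝ) ^ k * (D * r ^ W.card) := by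
          gcongr
          exact_mod_cast (by omega : W.card + 1 ≤ D)
      _ = (D : ℝ) ^ (k + 1) * r ^ W.card := by ring

lemma sum_pow_card_union_copyVerts_le {V : Type*} [Fintype V] [DecidableEq V] {r : ℝ} (hr : 0 ≤ r)
    (hrV : Fintype.card V * r ≤ 1) {D : ℕ} (M : Motif) (W : Finset V) (hD : W.card + M.v ≤ D) :
    ∑ f : Fin M.v ↪ V, r ^ (W ∪ copyVerts M f).card ≤ (D : ℝ) ^ M.v * r ^ W.card := by
  refine le_trans ?_ (sum_pow_card_union_image_le hr hrV M.v W hD)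
  have himage : ∀ f : Fin M.v ↪ V, copyVerts M f = Finset.univ.image f := fun f => by
    rw [copyVerts, Finset.map_eq_image]
  simp only [himage]
  refine (Finset.sum_map Finset.univ ⟨fun f : Fin M.v ↪ V => (f : Fin M.v → V),
    DFunLike.coe_injective⟩ fun f : Fin M.v → V =>
      r ^ (W ∪ Finset.univ.image f).card).symm.trans_le ?_
  exact Finset.sum_le_sum_of_subset_of_nonneg (Finset.subset_univ _) fun _ _ _ => by positivity

/-- Each of the `2 * (M.v + N.v)` vertices, placed in turn, contributes at most a factor equal to
the total number of vertices. The bound does not depend on the size of `V`. -/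
lemma sum_pow_card_union_four_copyVerts_le {V : Type*} [Fintype V] [DecidableEq V] {r : ℝ}
    (hr : 0 ≤ r) (hrV : Fintype.card V * r ≤ 1) (M N : Motif) :
    ∑ f₁ : Fin M.v ↪ V, ∑ f₂ : Fin N.v ↪ V, ∑ g₁ : Fin M.v ↪ V, ∑ g₂ : Fin N.v ↪ V,
      r ^ (copyVerts M f₁ ∪ copyVerts N f₂ ∪ copyVerts M g₁ ∪ copyVerts N g₂).card
      ≤ ((2 * (M.v + N.v) : ℕ) : ℝ) ^ (2 * (M.v + N.v)) := by
  set D := 2 * (M.v + N.v) with hD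
  have hcard : ∀ (L : Motif) (W : Finset V) (f : Fin L.v ↪ V),
      (W ∪ copyVerts L f).card ≤ W.card + L.v := fun L W f => by
    have := Finset.card_union_le W (copyVerts L f)
    rwa [card_copyVerts] at this
  calc _ ≤ ∑ f₁ : Fin M.v ↪ V, ∑ f₂ : Fin N.v ↪ V, ∑ g₁ : Fin M.v ↪ V,
        (D : ℝ) ^ N.v * r ^ (copyVerts M f₁ ∪ copyVerts N f₂ ∪ copyVerts M g₁).card := by
        refine Finset.sum_le_sum fun f₁ _ => Finset.sum_le_sum fun f₂ _ =>
          Finset.sum_le_sum fun g₁ _ => sum_pow_card_union_copyVerts_le hr hrV N _ ?_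
        have h1 := hcard N (copyVerts M f₁) f₂
        have h2 := hcard M (copyVerts M f₁ ∪ copyVerts N f₂) g₁
        rw [card_copyVerts] at h1
        omega
    _ ≤ ∑ f₁ : Fin M.v ↪ V, ∑ f₂ : Fin N.v ↪ V,
        (D : ℝ) ^ N.v * ((D : ℝ) ^ M.v * r ^ (copyVerts M f₁ ∪ copyVerts N f₂).card) := by
        refine Finset.sum_le_sum fun f₁ _ => Finset.sum_le_sum fun f₂ _ => ?_
        rw [← Finset.mul_sum]
        refine mul_le_mul_of_nonneg_left
          (sum_pow_card_union_copyVerts_le hr hrV M _ ?_) (by positivity)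
        have h1 := hcard N (copyVerts M f₁) f₂
        rw [card_copyVerts] at h1
        omega
    _ ≤ ∑ f₁ : Fin M.v ↪ V,
        (D : ℝ) ^ N.v * ((D : ℝ) ^ M.v * ((D : ℝ) ^ N.v * r ^ (copyVerts M f₁).card)) := by
        refine Finset.sum_le_sum fun f₁ _ => ?_
        rw [← Finset.mul_sum, ← Finset.mul_sum]
        refine mul_le_mul_of_nonneg_left (mul_le_mul_of_nonneg_left
          (sum_pow_card_union_copyVerts_le hr hrV N _ ?_) (by positivity)) (by positivity)
        rw [card_copyVerts]
        omega
    _ ≤ (D : ℝ) ^ N.v * ((D : ℝ) ^ M.v * ((D : ℝ) ^ N.v * ((D : ℝ) ^ M.v * 1))) := by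
        rw [← Finset.mul_sum, ← Finset.mul_sum, ← Finset.mul_sum]
        have := sum_pow_card_union_copyVerts_le hr hrV (D := D) M ∅ (by rw [Finset.card_empty]; omega)
        simp only [Finset.empty_union, Finset.card_empty, pow_zero] at this
        gcongr
    _ = (D : ℝ) ^ D := by rw [hD]; ring

end Counting

/-! ### The gain from a vertex lying in three copies -/

section Overlap

variable {n : ℕ} {p ε₀ : ℝ}

lemma rpow_le_of_subcopy {M : Motif}
    (hsub : ∀ M' : M.graph.Subgraph, M'.verts.Nonempty →
      (n : ℝ) ^ ε₀ ≤ (n : ℝ) ^ M'.verts.ncard * p ^ M'.edgeSet.ncard)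
    (f : Fin M.v ↪ Fin n) {W : Finset (Fin n)} (hW : W ⊆ copyVerts M f) (hne : W.Nonempty)
    {E : Finset (Sym2 (Fin n))} (hE : E ⊆ copyEdges M f) (hEW : ∀ a b, s(a, b) ∈ E → a ∈ W) :
    (n : ℝ) ^ ε₀ ≤ (n : ℝ) ^ W.card * p ^ E.card := by
  let M' : M.graph.Subgraph :=
    { verts := f ⁻¹' W
      Adj := fun a b => s(f a, f b) ∈ E
      adj_sub := fun h => mk_mem_copyEdges.1 (hE h)
      edge_vert := fun h => hEW _ _ h
      symm := ⟨fun a b h => by rwa [Sym2.eq_swap]⟩ }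
  have hverts : f '' M'.verts = W := by
    refine Set.image_preimage_eq_of_subset fun u hu => ?_
    exact mem_copyVerts.1 (hW hu)
  have hedges : f.sym2Map '' M'.edgeSet = E := by
    ext e
    constructor
    · rintro ⟨e', he', rfl⟩
      induction e' with | _ a b => exact he'
    · intro he
      obtain ⟨a, b, -, rfl⟩ := mem_copyEdges.1 (hE he)
      exact ⟨s(a, b), he, rfl⟩
  have h1 : M'.verts.ncard = W.card := by
    rw [← Set.ncard_image_of_injective _ f.injective, hverts, Set.ncard_coe_finset]
  have h2 : M'.edgeSet.ncard = E.card := by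
    rw [← Set.ncard_image_of_injective _ f.sym2Map.injective, hedges, Set.ncard_coe_finset]
  have hne' : M'.verts.Nonempty := by
    rw [← Set.image_nonempty (f := f), hverts]
    exact hne
  simpa only [h1, h2] using hsub M' hne'

lemma mem_inter_of_three {α : Type*} [DecidableEq α] {W : Fin 4 → Finset α} {i j k : Fin 4}
    (hij : i ≠ j) (hik : i ≠ k) (hjk : j ≠ k) {u : α} (hi : u ∈ W i) (hj : u ∈ W j)
    (hk : u ∈ W k) : u ∈ W 0 ∩ W 1 ∩ (W 2 ∪ W 3) ∨ u ∈ W 2 ∩ W 3 ∩ (W 0 ∪ W 1) := by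
  simp only [Finset.mem_inter, Finset.mem_union]
  fin_cases i <;> fin_cases j <;> fin_cases k <;> simp_all

/-- Counting multiplicities of vertices and of edges, the square of the right side is the square of
the union's weight times the weights of the overlaps `A` and `B`. Each overlap is a subgraph of a
copy, so its weight is at least `n ^ ε₀`, or equals `1` if it is empty. The triple vertex makes one
of them nonempty. -/
lemma union_weight_mul_le (hn : 0 < n) (hp0 : 0 < p) (hε : 0 < ε₀)
    {W : Fin 4 → Finset (Fin n)} {E : Fin 4 → Finset (Sym2 (Fin n))}
    (hcopy : ∀ i, IsConnectedCopy (W i) (E i))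
    (hcov : ∀ i, ∀ e ∈ E i, ∃ j, j ≠ i ∧ e ∈ E j)
    (hsub : ∀ i, ∀ W' ⊆ W i, W'.Nonempty → ∀ E' ⊆ E i, (∀ a b, s(a, b) ∈ E' → a ∈ W') →
      (n : ℝ) ^ ε₀ ≤ (n : ℝ) ^ W'.card * p ^ E'.card)
    {i j k : Fin 4} (hij : i ≠ j) (hik : i ≠ k) (hjk : j ≠ k) {u : Fin n} (hi : u ∈ W i)
    (hj : u ∈ W j) (hk : u ∈ W k) {v₁ v₂ e₁ e₂ : ℕ}
    (hW0 : (W 0).card = v₁) (hW1 : (W 1).card = v₂) (hW2 : (W 2).card = v₁)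
    (hW3 : (W 3).card = v₂) (hE0 : (E 0).card = e₁) (hE1 : (E 1).card = e₂)
    (hE2 : (E 2).card = e₁) (hE3 : (E 3).card = e₂) :
    (n : ℝ) ^ (W 0 ∪ W 1 ∪ W 2 ∪ W 3).card * p ^ (E 0 ∪ E 1 ∪ E 2 ∪ E 3).card *
      (n : ℝ) ^ (ε₀ / 2) ≤ (n : ℝ) ^ (v₁ + v₂) * p ^ (e₁ + e₂) := by
  have hn1 : (1 : ℝ) ≤ n := by exact_mod_cast hn
  have hcovW : ∀ i, ∀ x ∈ W i, ∃ j, j ≠ i ∧ x ∈ W j := by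
    intro i x hx
    obtain ⟨y, hy⟩ := (hcopy i).exists_edge hx
    obtain ⟨j, hj, hyj⟩ := hcov i _ hy
    exact ⟨j, hj, (hcopy j).mem_of_edge hyj⟩
  have hcardW := sum_card_of_covered_twice W hcovW
  have hcardE := sum_card_of_covered_twice E hcov
  rw [hW0, hW1, hW2, hW3] at hcardW
  rw [hE0, hE1, hE2, hE3] at hcardE
  set A := W 0 ∩ W 1 ∩ (W 2 ∪ W 3) with hA
  set B := W 2 ∩ W 3 ∩ (W 0 ∪ W 1) with hB
  set A' := E 0 ∩ E 1 ∩ (E 2 ∪ E 3) with hA'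
  set B' := E 2 ∩ E 3 ∩ (E 0 ∪ E 1) with hB'
  have hAA : ∀ a b, s(a, b) ∈ A' → a ∈ A := by
    intro a b h
    simp only [hA', hA, Finset.mem_inter, Finset.mem_union] at h ⊢
    exact ⟨⟨(hcopy 0).mem_of_edge h.1.1, (hcopy 1).mem_of_edge h.1.2⟩,
      h.2.imp (hcopy 2).mem_of_edge (hcopy 3).mem_of_edge⟩
  have hBB : ∀ a b, s(a, b) ∈ B' → a ∈ B := by
    intro a b h
    simp only [hB', hB, Finset.mem_inter, Finset.mem_union] at h ⊢
    exact ⟨⟨(hcopy 2).mem_of_edge h.1.1, (hcopy 3).mem_of_edge h.1.2⟩,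
      h.2.imp (hcopy 0).mem_of_edge (hcopy 1).mem_of_edge⟩
  have hAsub : A.Nonempty → (n : ℝ) ^ ε₀ ≤ (n : ℝ) ^ A.card * p ^ A'.card := fun h =>
    hsub 0 A (Finset.inter_subset_left.trans Finset.inter_subset_left) h A'
      (Finset.inter_subset_left.trans Finset.inter_subset_left) hAA
  have hBsub : B.Nonempty → (n : ℝ) ^ ε₀ ≤ (n : ℝ) ^ B.card * p ^ B'.card := fun h =>
    hsub 2 B (Finset.inter_subset_left.trans Finset.inter_subset_left) h B'
      (Finset.inter_subset_left.trans Finset.inter_subset_left) hBB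
  have hnε : (1 : ℝ) ≤ (n : ℝ) ^ ε₀ := Real.one_le_rpow hn1 hε.le
  have hone : ∀ (S : Finset (Fin n)) (S' : Finset (Sym2 (Fin n))),
      (∀ a b, s(a, b) ∈ S' → a ∈ S) →
      (S.Nonempty → (n : ℝ) ^ ε₀ ≤ (n : ℝ) ^ S.card * p ^ S'.card) →
      1 ≤ (n : ℝ) ^ S.card * p ^ S'.card := by
    intro S S' h h'
    rcases S.eq_empty_or_nonempty with hS | hS
    · have : S' = ∅ := by
        rw [Finset.eq_empty_iff_forall_notMem]
        intro e he
        induction e with | _ a b => exact absurd (h a b he) (by simp [hS])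
      simp [hS, this]
    · exact hnε.trans (h' hS)
  have hprod : (n : ℝ) ^ ε₀ ≤ ((n : ℝ) ^ A.card * p ^ A'.card) * ((n : ℝ) ^ B.card * p ^ B'.card) := by
    rcases mem_inter_of_three hij hik hjk hi hj hk with h | h
    · exact (hAsub ⟨u, h⟩).trans (le_mul_of_one_le_right (by positivity) (hone B B' hBB hBsub))
    · exact (hBsub ⟨u, h⟩).trans (le_mul_of_one_le_left (by positivity) (hone A A' hAA hAsub))
  -- The multiplicity identities count each union twice, so the squares are compared; the square
  -- root is what turns `ε₀` into `ε₀ / 2`.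
  rw [← pow_le_pow_iff_left₀ (by positivity) (by positivity) two_ne_zero]
  have hsq : ((n : ℝ) ^ (ε₀ / 2)) ^ 2 = (n : ℝ) ^ ε₀ := by
    rw [← Real.rpow_natCast, ← Real.rpow_mul (by positivity)]
    norm_num
  calc _ = ((n : ℝ) ^ (W 0 ∪ W 1 ∪ W 2 ∪ W 3).card) ^ 2 *
        (p ^ (E 0 ∪ E 1 ∪ E 2 ∪ E 3).card) ^ 2 * (n : ℝ) ^ ε₀ := by rw [← hsq]; ring
    _ ≤ ((n : ℝ) ^ (W 0 ∪ W 1 ∪ W 2 ∪ W 3).card) ^ 2 *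
        (p ^ (E 0 ∪ E 1 ∪ E 2 ∪ E 3).card) ^ 2 *
        (((n : ℝ) ^ A.card * p ^ A'.card) * ((n : ℝ) ^ B.card * p ^ B'.card)) := by gcongr
    _ = (n : ℝ) ^ (2 * (W 0 ∪ W 1 ∪ W 2 ∪ W 3).card + A.card + B.card) *
        p ^ (2 * (E 0 ∪ E 1 ∪ E 2 ∪ E 3).card + A'.card + B'.card) := by ring
    _ = _ := by rw [← hcardW, ← hcardE]; ring

end Overlap

/-! ### Moments of four edge sets -/

section EdgeMoments

variable {n : ℕ} {p ρ : ℝ}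

/-- The expectation of the product of the centred bits over four sets of vertex pairs, of which
the first two refer to the first graph and the others to the second. -/
noncomputable def edgeMoment (p ρ : ℝ) (E : Fin 4 → Finset (Sym2 (Fin n))) : ℝ :=
  ∏ e, bitMoment p ρ (multiplicity (E 0) (E 1) e) (multiplicity (E 2) (E 3) e)

/-- A vertex pair in only one of the sets contributes the mean of a centred bit, which is zero. -/
lemma covered_of_edgeMoment_ne_zero (hp0 : 0 < p) (hp : p ≤ 1 / 2) (hρ0 : 0 < ρ) (hρ : ρ ≤ 1)
    (E : Fin 4 → Finset (Sym2 (Fin n))) (h : edgeMoment p ρ E ≠ 0) (i : Fin 4) (e : Sym2 (Fin n))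
    (he : e ∈ E i) : ∃ j, j ≠ i ∧ e ∈ E j := by
  have h' := Finset.prod_ne_zero_iff.1 h e (Finset.mem_univ e)
  by_contra! hne
  have h0 := hne 0
  have h1 := hne 1
  have h2 := hne 2
  have h3 := hne 3
  have m1 := bitMoment_one_zero hp0 hp hρ0 hρ
  have m2 := bitMoment_zero_one hp0 hp hρ0 hρ
  fin_cases i <;> simp_all [multiplicity]

lemma edgeMoment_nonneg_and_le (hp0 : 0 < p) (hp : p ≤ 1 / 2) (hρ0 : 0 < ρ) (hρ : ρ ≤ 1)
    (E : Fin 4 → Finset (Sym2 (Fin n))) : 0 ≤ edgeMoment p ρ E ∧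
    edgeMoment p ρ E ≤ (p * (1 - p)) ^ (E 0 ∪ E 1 ∪ E 2 ∪ E 3).card := by
  have hm : ∀ A B : Finset (Sym2 (Fin n)), ∀ e, multiplicity A B e ≤ 2 := fun A B e => by
    unfold multiplicity; split_ifs <;> norm_num
  have key : ∀ e, 0 ≤ bitMoment p ρ (multiplicity (E 0) (E 1) e) (multiplicity (E 2) (E 3) e) ∧
      bitMoment p ρ (multiplicity (E 0) (E 1) e) (multiplicity (E 2) (E 3) e)
        ≤ if e ∈ E 0 ∪ E 1 ∪ E 2 ∪ E 3 then p * (1 - p) else 1 := by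
    intro e
    by_cases he : e ∈ E 0 ∪ E 1 ∪ E 2 ∪ E 3
    · rw [if_pos he]
      refine bitMoment_mem_Icc hp0 hp hρ0 hρ (hm _ _ _) (hm _ _ _) ?_
      simp only [Finset.mem_union] at he
      unfold multiplicity
      rcases he with ((he | he) | he) | he <;> simp [he]
    · rw [if_neg he]
      simp only [Finset.mem_union, not_or] at he
      simp [multiplicity, he, bitMoment_zero_zero hp0 hp hρ0 hρ]
  refine ⟨Finset.prod_nonneg fun e _ => (key e).1, ?_⟩
  refine (Finset.prod_le_prod (fun e _ => (key e).1) fun e _ => (key e).2).trans_eq ?_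
  rw [Finset.prod_ite_mem, Finset.univ_inter, Finset.prod_const]

lemma prod_ite_mem_mul_ite_mem {α : Type*} [Fintype α] [DecidableEq α] (A B : Finset α) (c : ℝ) :
    ∏ e, ((if e ∈ A then c else 1) * if e ∈ B then c else 1) = c ^ (A.card + B.card) := by
  rw [Finset.prod_mul_distrib, Finset.prod_ite_mem, Finset.prod_ite_mem, Finset.univ_inter,
    Finset.univ_inter, Finset.prod_const, Finset.prod_const, pow_add]

lemma edgeMoment_of_eq (hp0 : 0 < p) (hp : p ≤ 1 / 2) (hρ0 : 0 < ρ) (hρ : ρ ≤ 1)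
    (E : Fin 4 → Finset (Sym2 (Fin n)))
    (h02 : E 0 = E 2) (h13 : E 1 = E 3) (hd : Disjoint (E 0) (E 1)) :
    edgeMoment p ρ E = (ρ * (p * (1 - p))) ^ ((E 0).card + (E 1).card) := by
  rw [← prod_ite_mem_mul_ite_mem, edgeMoment, ← h02, ← h13]
  refine Finset.prod_congr rfl fun e _ => ?_
  have hnot : e ∈ E 0 → e ∉ E 1 := fun h => Finset.disjoint_left.1 hd h
  by_cases h0 : e ∈ E 0 <;> by_cases h1 : e ∈ E 1 <;>
    simp_all [multiplicity, bitMoment_one_one hp0 hp hρ0 hρ, bitMoment_zero_zero hp0 hp hρ0 hρ]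

lemma edgeMoment_of_eq_swap (hp0 : 0 < p) (hp : p ≤ 1 / 2) (hρ0 : 0 < ρ) (hρ : ρ ≤ 1)
    (E : Fin 4 → Finset (Sym2 (Fin n)))
    (h03 : E 0 = E 3) (h12 : E 1 = E 2) (hd : Disjoint (E 0) (E 1)) :
    edgeMoment p ρ E = (ρ * (p * (1 - p))) ^ ((E 0).card + (E 1).card) := by
  rw [← prod_ite_mem_mul_ite_mem, edgeMoment, ← h03, ← h12]
  refine Finset.prod_congr rfl fun e _ => ?_
  have hnot : e ∈ E 0 → e ∉ E 1 := fun h => Finset.disjoint_left.1 hd h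
  by_cases h0 : e ∈ E 0 <;> by_cases h1 : e ∈ E 1 <;>
    simp_all [multiplicity, bitMoment_one_one hp0 hp hρ0 hρ, bitMoment_zero_zero hp0 hp hρ0 hρ]

/-- Here each pair of copies lives inside a single graph, so variances appear in place of
covariances and there is no power of `ρ`. -/
lemma edgeMoment_of_eq_same (hp0 : 0 < p) (hp : p ≤ 1 / 2) (hρ0 : 0 < ρ) (hρ : ρ ≤ 1)
    (E : Fin 4 → Finset (Sym2 (Fin n)))
    (h01 : E 0 = E 1) (h23 : E 2 = E 3) (hd : Disjoint (E 0) (E 2)) :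
    edgeMoment p ρ E = (p * (1 - p)) ^ ((E 0).card + (E 2).card) := by
  rw [← prod_ite_mem_mul_ite_mem, edgeMoment, ← h01, ← h23]
  refine Finset.prod_congr rfl fun e _ => ?_
  have hnot : e ∈ E 0 → e ∉ E 2 := fun h => Finset.disjoint_left.1 hd h
  by_cases h0 : e ∈ E 0 <;> by_cases h1 : e ∈ E 2 <;>
    simp_all [multiplicity, bitMoment_two_zero hp0 hp hρ0 hρ, bitMoment_zero_two hp0 hp hρ0 hρ,
      bitMoment_zero_zero hp0 hp hρ0 hρ]

end EdgeMoments

/-! ### Bound for one configuration of four copies -/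

section LocalBound

variable {n : ℕ} {p ρ ε₀ : ℝ}

lemma pow_union_le_of_weight_le (hp0 : 0 < p) (hp : p ≤ 1 / 2) (hn : 0 < n) {u v k m : ℕ}
    (hkm : k ≤ m)
    (h : (n : ℝ) ^ u * p ^ k * (n : ℝ) ^ (ε₀ / 2) ≤ (n : ℝ) ^ v * p ^ m) :
    (p * (1 - p)) ^ k ≤
      2 ^ m * (n : ℝ) ^ (-ε₀ / 2) * (n : ℝ) ^ v * (p * (1 - p)) ^ m * ((n : ℝ)⁻¹) ^ u := by
  obtain ⟨l, rfl⟩ := Nat.exists_eq_add_of_le hkm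
  have hn0 : (0 : ℝ) < n := by exact_mod_cast hn
  have hq : 0 < p * (1 - p) := mul_pos hp0 (by linarith)
  have hneg : (n : ℝ) ^ (-ε₀ / 2) = ((n : ℝ) ^ (ε₀ / 2))⁻¹ := by
    rw [← Real.rpow_neg hn0.le, neg_div]
  have hpos : 0 < (n : ℝ) ^ (ε₀ / 2) := Real.rpow_pos_of_pos hn0 _
  have h1 : (n : ℝ) ^ u * (n : ℝ) ^ (ε₀ / 2) ≤ (n : ℝ) ^ v * p ^ l := by
    have hpk : 0 < p ^ k := by positivity
    refine le_of_mul_le_mul_right ?_ hpk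
    calc _ = (n : ℝ) ^ u * p ^ k * (n : ℝ) ^ (ε₀ / 2) := by ring
      _ ≤ _ := h
      _ = _ := by ring
  -- Since `p ≤ 1 / 2`, `p` is at most `2 * (p * (1 - p))`. The power of two is enlarged to `k + l`
  -- so that it no longer depends on the configuration.
  have h2 : p ^ l ≤ 2 ^ (k + l) * (p * (1 - p)) ^ l := by
    calc p ^ l ≤ (2 * (p * (1 - p))) ^ l := by
          gcongr
          nlinarith
      _ = 2 ^ l * (p * (1 - p)) ^ l := mul_pow _ _ _
      _ ≤ _ := by
          gcongr
          · norm_num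
          · omega
  have h3 : (n : ℝ) ^ u * (n : ℝ) ^ (ε₀ / 2) ≤
      (n : ℝ) ^ v * (2 ^ (k + l) * (p * (1 - p)) ^ l) := h1.trans (by gcongr)
  rw [hneg, inv_pow]
  have h4 : 1 ≤ (n : ℝ) ^ v * (2 ^ (k + l) * (p * (1 - p)) ^ l) *
      ((n : ℝ) ^ u * (n : ℝ) ^ (ε₀ / 2))⁻¹ := by
    rw [← div_eq_mul_inv, one_le_div (by positivity)]
    exact h3
  calc (p * (1 - p)) ^ k ≤ (p * (1 - p)) ^ k * ((n : ℝ) ^ v * (2 ^ (k + l) * (p * (1 - p)) ^ l) *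
      ((n : ℝ) ^ u * (n : ℝ) ^ (ε₀ / 2))⁻¹) := le_mul_of_one_le_right (by positivity) h4
    _ = _ := by rw [mul_inv]; ring

/-- The property of a motif that admissibility grants to every motif with an edge. -/
structure Motif.IsDense (n : ℕ) (p ε₀ : ℝ) (M : Motif) : Prop where
  connected : M.graph.Connected
  e_ne_zero : M.e ≠ 0
  subgraph : ∀ M' : M.graph.Subgraph, M'.verts.Nonempty →
    (n : ℝ) ^ ε₀ ≤ (n : ℝ) ^ M'.verts.ncard * p ^ M'.edgeSet.ncard

lemma edgeMoment_copies_le (hn : 0 < n) (hp0 : 0 < p) (hp : p ≤ 1 / 2) (hρ0 : 0 < ρ) (hρ : ρ ≤ 1)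
    (hε : 0 < ε₀) {M N : Motif} (hM : M.IsDense n p ε₀) (hN : N.IsDense n p ε₀)
    (f₁ g₁ : Fin M.v ↪ Fin n) (f₂ g₂ : Fin N.v ↪ Fin n) :
    edgeMoment p ρ ![copyEdges M f₁, copyEdges N f₂, copyEdges M g₁, copyEdges N g₂] ≤
      (ρ * (p * (1 - p))) ^ (M.e + N.e) * ((if copyEdges M f₁ = copyEdges M g₁ then 1 else 0) *
        (if copyEdges N f₂ = copyEdges N g₂ then 1 else 0))
      + (ρ * (p * (1 - p))) ^ (M.e + N.e) * ((if copyEdges M f₁ = copyEdges N g₂ then 1 else 0) *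
        (if copyEdges M g₁ = copyEdges N f₂ then 1 else 0))
      + (p * (1 - p)) ^ (M.e + N.e) * ((if copyEdges M f₁ = copyEdges N f₂ then 1 else 0) *
        (if copyEdges M g₁ = copyEdges N g₂ then 1 else 0))
      + 2 ^ (M.e + N.e) * (n : ℝ) ^ (-ε₀ / 2) * (n : ℝ) ^ (M.v + N.v) *
        (p * (1 - p)) ^ (M.e + N.e) * ((n : ℝ)⁻¹) ^
          (copyVerts M f₁ ∪ copyVerts N f₂ ∪ copyVerts M g₁ ∪ copyVerts N g₂).card := by
  have hq : 0 < p * (1 - p) := mul_pos hp0 (by linarith)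
  set E : Fin 4 → Finset (Sym2 (Fin n)) :=
    ![copyEdges M f₁, copyEdges N f₂, copyEdges M g₁, copyEdges N g₂] with hE
  set W : Fin 4 → Finset (Fin n) :=
    ![copyVerts M f₁, copyVerts N f₂, copyVerts M g₁, copyVerts N g₂] with hW
  have hite : ∀ P : Prop, [Decidable P] → (0 : ℝ) ≤ if P then 1 else 0 := fun P _ => by
    split_ifs <;> norm_num
  set R₁ : ℝ := (ρ * (p * (1 - p))) ^ (M.e + N.e) *
    ((if copyEdges M f₁ = copyEdges M g₁ then 1 else 0) *
      (if copyEdges N f₂ = copyEdges N g₂ then 1 else 0)) with hR₁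
  set R₂ : ℝ := (ρ * (p * (1 - p))) ^ (M.e + N.e) *
    ((if copyEdges M f₁ = copyEdges N g₂ then 1 else 0) *
      (if copyEdges M g₁ = copyEdges N f₂ then 1 else 0)) with hR₂
  set R₃ : ℝ := (p * (1 - p)) ^ (M.e + N.e) *
    ((if copyEdges M f₁ = copyEdges N f₂ then 1 else 0) *
      (if copyEdges M g₁ = copyEdges N g₂ then 1 else 0)) with hR₃
  set R₄ : ℝ := 2 ^ (M.e + N.e) * (n : ℝ) ^ (-ε₀ / 2) * (n : ℝ) ^ (M.v + N.v) *
    (p * (1 - p)) ^ (M.e + N.e) * ((n : ℝ)⁻¹) ^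
      (copyVerts M f₁ ∪ copyVerts N f₂ ∪ copyVerts M g₁ ∪ copyVerts N g₂).card with hR₄
  have h1 : 0 ≤ R₁ := mul_nonneg (by positivity) (mul_nonneg (hite _) (hite _))
  have h2 : 0 ≤ R₂ := mul_nonneg (by positivity) (mul_nonneg (hite _) (hite _))
  have h3 : 0 ≤ R₃ := mul_nonneg (by positivity) (mul_nonneg (hite _) (hite _))
  have h4 : 0 ≤ R₄ := by positivity
  by_cases hzero : edgeMoment p ρ E = 0
  · rw [hzero]; positivity
  have hcov := covered_of_edgeMoment_ne_zero hp0 hp hρ0 hρ E hzero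
  have hcopy : ∀ i, IsConnectedCopy (W i) (E i) := by
    intro i
    fin_cases i
    · exact isConnectedCopy_copy hM.connected hM.e_ne_zero f₁
    · exact isConnectedCopy_copy hN.connected hN.e_ne_zero f₂
    · exact isConnectedCopy_copy hM.connected hM.e_ne_zero g₁
    · exact isConnectedCopy_copy hN.connected hN.e_ne_zero g₂
  have c0 : (E 0).card = M.e := card_copyEdges M f₁
  have c1 : (E 1).card = N.e := card_copyEdges N f₂
  have c2 : (E 2).card = M.e := card_copyEdges M g₁
  have c3 : (E 3).card = N.e := card_copyEdges N g₂
  by_cases hthree : ∀ i j k, i ≠ j → i ≠ k → j ≠ k → ∀ u, u ∈ W i → u ∈ W j → u ∉ W k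
  · rcases copies_eq_in_pairs hcopy hcov hthree with ⟨ha, hb, hd⟩ | ⟨ha, hb, hd⟩ | ⟨ha, hb, hd⟩
    · have := edgeMoment_of_eq hp0 hp hρ0 hρ E ha hb hd
      rw [c0, c1] at this
      have ha' : copyEdges M f₁ = copyEdges M g₁ := ha
      have hb' : copyEdges N f₂ = copyEdges N g₂ := hb
      rw [if_pos ha', if_pos hb', mul_one, mul_one] at hR₁
      linarith
    · have := edgeMoment_of_eq_swap hp0 hp hρ0 hρ E ha hb hd
      rw [c0, c1] at this
      have ha' : copyEdges M f₁ = copyEdges N g₂ := ha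
      have hb' : copyEdges M g₁ = copyEdges N f₂ := hb.symm
      rw [if_pos ha', if_pos hb', mul_one, mul_one] at hR₂
      linarith
    · have := edgeMoment_of_eq_same hp0 hp hρ0 hρ E ha hb hd
      rw [hb, c0, c3] at this
      have ha' : copyEdges M f₁ = copyEdges N f₂ := ha
      have hb' : copyEdges M g₁ = copyEdges N g₂ := hb
      rw [if_pos ha', if_pos hb', mul_one, mul_one] at hR₃
      linarith
  · push Not at hthree
    obtain ⟨i, j, k, hij, hik, hjk, u, hi, hj, hk⟩ := hthree
    have hsub : ∀ i, ∀ W' ⊆ W i, W'.Nonempty → ∀ E' ⊆ E i, (∀ a b, s(a, b) ∈ E' → a ∈ W') →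
        (n : ℝ) ^ ε₀ ≤ (n : ℝ) ^ W'.card * p ^ E'.card := by
      intro i W' hW' hne E' hE' h
      fin_cases i
      · exact rpow_le_of_subcopy hM.subgraph f₁ hW' hne hE' h
      · exact rpow_le_of_subcopy hN.subgraph f₂ hW' hne hE' h
      · exact rpow_le_of_subcopy hM.subgraph g₁ hW' hne hE' h
      · exact rpow_le_of_subcopy hN.subgraph g₂ hW' hne hE' h
    have hover := union_weight_mul_le hn hp0 hε hcopy hcov hsub hij hik hjk hi hj hk
      (card_copyVerts M f₁) (card_copyVerts N f₂) (card_copyVerts M g₁) (card_copyVerts N g₂)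
      c0 c1 c2 c3
    -- The four sets have `2 * (M.e + N.e)` edges with multiplicity, and each is counted at least
    -- twice.
    have hkm : (E 0 ∪ E 1 ∪ E 2 ∪ E 3).card ≤ M.e + N.e := by
      have := sum_card_of_covered_twice E hcov
      rw [c0, c1, c2, c3] at this
      omega
    have := (edgeMoment_nonneg_and_le hp0 hp hρ0 hρ E).2.trans
      (pow_union_le_of_weight_le hp0 hp hn hkm hover)
    have hR : edgeMoment p ρ E ≤ R₄ := this
    linarith

end LocalBound

/-! ### Coinciding copies and the normalisation of the weights -/

section PairCount

/-- The number of pairs of copies of `M` and of `N` in the complete graph on `n` vertices that have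
the same edges. -/
noncomputable def pairCount (n : ℕ) (M N : Motif) : ℝ :=
  ∑ f : Fin M.v ↪ Fin n, ∑ g : Fin N.v ↪ Fin n, if copyEdges M f = copyEdges N g then 1 else 0

variable {n : ℕ} {p ρ : ℝ} {M N : Motif}

lemma descFactorial_mul_aut_le_pairCount :
    (n.descFactorial M.v : ℝ) * M.aut ≤ pairCount n M M := by
  have : ∀ f : Fin M.v ↪ Fin n, (M.aut : ℝ) ≤
      ∑ g : Fin M.v ↪ Fin n, if copyEdges M f = copyEdges M g then 1 else 0 := fun f => by
    rw [Finset.sum_boole]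
    exact_mod_cast aut_le_card_copyEdges_eq f
  refine le_trans (le_of_eq ?_) (Finset.sum_le_sum fun f _ => this f)
  simp [Fintype.card_embedding_eq]

lemma pairCount_self_le (hM : M.graph.Connected) (hMe : M.e ≠ 0) :
    pairCount n M M ≤ (n.descFactorial M.v : ℝ) * M.aut := by
  have : ∀ f : Fin M.v ↪ Fin n,
      (∑ g : Fin M.v ↪ Fin n, if copyEdges M f = copyEdges M g then (1 : ℝ) else 0) ≤ M.aut :=
    fun f => by
      rw [Finset.sum_boole]
      exact_mod_cast card_copyEdges_eq_le_aut hM hMe f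
  refine le_trans (Finset.sum_le_sum fun f _ => this f) (le_of_eq ?_)
  simp [Fintype.card_embedding_eq]

lemma pairCount_nonneg : 0 ≤ pairCount n M N :=
  Finset.sum_nonneg fun _ _ => Finset.sum_nonneg fun _ _ => by split_ifs <;> norm_num

lemma pairCount_eq_zero (hM : M.graph.Connected) (hMe : M.e ≠ 0) (hN : N.graph.Connected)
    (hNe : N.e ≠ 0) (hMN : ¬ Nonempty (M.graph ≃g N.graph)) : pairCount n M N = 0 := by
  refine Finset.sum_eq_zero fun f _ => Finset.sum_eq_zero fun g _ => if_neg fun h => hMN ?_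
  obtain ⟨σ, -⟩ := exists_iso_of_copyEdges_eq hM hMe hN hNe h
  exact ⟨σ⟩

lemma weight_nonneg (hp0 : 0 < p) (hp : p ≤ 1 / 2) (hρ0 : 0 < ρ) : 0 ≤ weight n p ρ M := by
  have hq : 0 < p * (1 - p) := mul_pos hp0 (by linarith)
  unfold weight
  positivity

lemma weight_mul_descFactorial_mul_aut (hp0 : 0 < p) (hp : p ≤ 1 / 2) (hv : M.v ≤ n) :
    weight n p ρ M * ((n.descFactorial M.v : ℝ) * M.aut) * (p * (1 - p)) ^ M.e = ρ ^ M.e := by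
  have hq : 0 < p * (1 - p) := mul_pos hp0 (by linarith)
  have haut : (M.aut : ℝ) ≠ 0 := by exact_mod_cast M.aut_pos.ne'
  have hfac : ((n - M.v).factorial : ℝ) * n.descFactorial M.v = n.factorial := by
    exact_mod_cast Nat.factorial_mul_descFactorial hv
  have hn : (n.factorial : ℝ) ≠ 0 := by exact_mod_cast n.factorial_ne_zero
  rw [weight, div_mul_eq_mul_div, div_mul_eq_mul_div, div_eq_iff (by positivity), ← hfac]
  ring

lemma pow_le_two_pow_mul_descFactorial {v : ℕ} (h : 2 * v ≤ n) :
    (n : ℝ) ^ v ≤ 2 ^ v * n.descFactorial v := by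
  have h1 : n ^ v ≤ 2 ^ v * n.descFactorial v := by
    calc n ^ v ≤ (2 * (n + 1 - v)) ^ v := Nat.pow_le_pow_left (by omega) v
      _ = 2 ^ v * (n + 1 - v) ^ v := mul_pow _ _ _
      _ ≤ _ := Nat.mul_le_mul_left _ (Nat.pow_sub_le_descFactorial n v)
  exact_mod_cast h1

/-- The overlap terms carry `n ^ v` instead of the falling factorial that the weight cancels. For `2
* v ≤ n` this costs at most `2 ^ v`. -/
lemma weight_mul_pow_le (hp0 : 0 < p) (hp : p ≤ 1 / 2) (hρ0 : 0 < ρ) (hv : 2 * M.v ≤ n) :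
    weight n p ρ M * (n : ℝ) ^ M.v * (p * (1 - p)) ^ M.e ≤ 2 ^ M.v * ρ ^ M.e := by
  have hq : 0 < p * (1 - p) := mul_pos hp0 (by linarith)
  have hw : 0 ≤ weight n p ρ M := weight_nonneg hp0 hp hρ0
  have haut : (1 : ℝ) ≤ M.aut := by exact_mod_cast M.aut_pos
  rw [← weight_mul_descFactorial_mul_aut (n := n) (ρ := ρ) hp0 hp (by omega)]
  calc _ ≤ weight n p ρ M * (2 ^ M.v * n.descFactorial M.v) * (p * (1 - p)) ^ M.e := by
        gcongr
        exact pow_le_two_pow_mul_descFactorial hv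
    _ ≤ weight n p ρ M * (2 ^ M.v * (n.descFactorial M.v * M.aut)) * (p * (1 - p)) ^ M.e := by
        gcongr
        exact le_mul_of_one_le_right (by positivity) haut
    _ = _ := by ring

end PairCount

/-! ### First and second moments of embedding counts -/

section Moments

variable {n : ℕ} {p ρ ε₀ : ℝ}

lemma integral_injCount_mul (hp0 : 0 < p) (hp : p ≤ 1 / 2) (hρ0 : 0 < ρ) (hρ : ρ ≤ 1)
    (M : Motif) :
    ∫ x, injCount M (fun e => bitVal p (x e).1) * injCount M (fun e => bitVal p (x e).2)
      ∂bitLaw n p ρ = ∑ f : Fin M.v ↪ Fin n, ∑ g : Fin M.v ↪ Fin n,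
        edgeMoment p ρ ![copyEdges M f, ∅, copyEdges M g, ∅] := by
  have := isProbabilityMeasure_corrBernoulli hp0 hp hρ0 hρ
  have : IsProbabilityMeasure (bitLaw n p ρ) := by unfold bitLaw; infer_instance
  simp only [injCount, homWeight_eq_prod_copyEdges, Finset.sum_mul_sum]
  rw [integral_finsetSum _ fun _ _ => Integrable.of_finite]
  refine Finset.sum_congr rfl fun f _ => ?_
  rw [integral_finsetSum _ fun _ _ => Integrable.of_finite]
  refine Finset.sum_congr rfl fun g _ => ?_
  have := integral_bitLaw_prod hp0 hp hρ0 hρ (copyEdges M f) ∅ (copyEdges M g) ∅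
  simpa [edgeMoment] using this

lemma sum_mul_sum_mul_sum_mul_sum {ι κ : Type*} [Fintype ι] [Fintype κ] (a c : ι → ℝ)
    (b d : κ → ℝ) : (∑ i, a i) * (∑ j, b j) * ((∑ i, c i) * ∑ j, d j)
      = ∑ i, ∑ j, ∑ k, ∑ l, a i * b j * (c k * d l) := by
  rw [Finset.sum_mul_sum, Finset.sum_mul_sum]
  simp only [Finset.sum_mul]
  simp only [Finset.mul_sum]

lemma integral_injCount_mul_mul (hp0 : 0 < p) (hp : p ≤ 1 / 2) (hρ0 : 0 < ρ) (hρ : ρ ≤ 1)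
    (M N : Motif) :
    ∫ x, injCount M (fun e => bitVal p (x e).1) * injCount N (fun e => bitVal p (x e).1) *
      (injCount M (fun e => bitVal p (x e).2) * injCount N (fun e => bitVal p (x e).2))
      ∂bitLaw n p ρ = ∑ f₁ : Fin M.v ↪ Fin n, ∑ f₂ : Fin N.v ↪ Fin n,
        ∑ g₁ : Fin M.v ↪ Fin n, ∑ g₂ : Fin N.v ↪ Fin n,
        edgeMoment p ρ ![copyEdges M f₁, copyEdges N f₂, copyEdges M g₁, copyEdges N g₂] := by
  have := isProbabilityMeasure_corrBernoulli hp0 hp hρ0 hρ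
  have : IsProbabilityMeasure (bitLaw n p ρ) := by unfold bitLaw; infer_instance
  simp only [injCount, homWeight_eq_prod_copyEdges, sum_mul_sum_mul_sum_mul_sum]
  rw [integral_finsetSum _ fun _ _ => Integrable.of_finite]
  refine Finset.sum_congr rfl fun f₁ _ => ?_
  rw [integral_finsetSum _ fun _ _ => Integrable.of_finite]
  refine Finset.sum_congr rfl fun f₂ _ => ?_
  rw [integral_finsetSum _ fun _ _ => Integrable.of_finite]
  refine Finset.sum_congr rfl fun g₁ _ => ?_
  rw [integral_finsetSum _ fun _ _ => Integrable.of_finite]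
  refine Finset.sum_congr rfl fun g₂ _ => ?_
  exact integral_bitLaw_prod hp0 hp hρ0 hρ (copyEdges M f₁) (copyEdges N f₂) (copyEdges M g₁)
    (copyEdges N g₂)

/-- Only coinciding copies are kept. All other terms are nonnegative, and a lower bound on the mean
is enough. -/
lemma le_integral_injCount_mul (hp0 : 0 < p) (hp : p ≤ 1 / 2) (hρ0 : 0 < ρ) (hρ : ρ ≤ 1)
    (M : Motif) : (ρ * (p * (1 - p))) ^ M.e * pairCount n M M ≤
      ∫ x, injCount M (fun e => bitVal p (x e).1) * injCount M (fun e => bitVal p (x e).2)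
        ∂bitLaw n p ρ := by
  rw [integral_injCount_mul hp0 hp hρ0 hρ, pairCount, Finset.mul_sum]
  refine Finset.sum_le_sum fun f _ => ?_
  rw [Finset.mul_sum]
  refine Finset.sum_le_sum fun g _ => ?_
  set E : Fin 4 → Finset (Sym2 (Fin n)) := ![copyEdges M f, ∅, copyEdges M g, ∅] with hE
  split_ifs with h
  · rw [edgeMoment_of_eq hp0 hp hρ0 hρ E h rfl (Finset.disjoint_empty_right _)]
    simp [hE, card_copyEdges]
  · rw [mul_zero]
    exact (edgeMoment_nonneg_and_le hp0 hp hρ0 hρ E).1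

lemma signalScore_le_integral_bitStatistic (hp0 : 0 < p) (hp : p ≤ 1 / 2) (hρ0 : 0 < ρ)
    (hρ : ρ ≤ 1) (𝓕 : Finset Motif) (hv : ∀ M ∈ 𝓕, M.v ≤ n) :
    signalScore ρ 𝓕 ≤ ∫ x, bitStatistic n p ρ 𝓕 x ∂bitLaw n p ρ := by
  have := isProbabilityMeasure_corrBernoulli hp0 hp hρ0 hρ
  have : IsProbabilityMeasure (bitLaw n p ρ) := by unfold bitLaw; infer_instance
  have hq : 0 < p * (1 - p) := mul_pos hp0 (by linarith)
  simp only [bitStatistic]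
  rw [integral_finsetSum _ fun _ _ => Integrable.of_finite]
  refine Finset.sum_le_sum fun M hM => ?_
  have hw : 0 ≤ weight n p ρ M := weight_nonneg hp0 hp hρ0
  simp only [mul_assoc (weight n p ρ M)]
  rw [integral_const_mul]
  calc ρ ^ (2 * M.e) = ρ ^ M.e *
        (weight n p ρ M * ((n.descFactorial M.v : ℝ) * M.aut) * (p * (1 - p)) ^ M.e) := by
        rw [weight_mul_descFactorial_mul_aut hp0 hp (hv M hM)]; ring
    _ = weight n p ρ M * ((ρ * (p * (1 - p))) ^ M.e * ((n.descFactorial M.v : ℝ) * M.aut)) := by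
        rw [mul_pow ρ]; ring
    _ ≤ weight n p ρ M * ((ρ * (p * (1 - p))) ^ M.e * pairCount n M M) := by
        gcongr
        exact descFactorial_mul_aut_le_pairCount
    _ ≤ _ := by
        gcongr
        exact le_integral_injCount_mul hp0 hp hρ0 hρ M

lemma integral_injCount_mul_mul_le (hn : 0 < n) (hp0 : 0 < p) (hp : p ≤ 1 / 2) (hρ0 : 0 < ρ)
    (hρ : ρ ≤ 1) (hε : 0 < ε₀) {M N : Motif} (hM : M.IsDense n p ε₀) (hN : N.IsDense n p ε₀) :
    ∫ x, injCount M (fun e => bitVal p (x e).1) * injCount N (fun e => bitVal p (x e).1) *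
      (injCount M (fun e => bitVal p (x e).2) * injCount N (fun e => bitVal p (x e).2))
      ∂bitLaw n p ρ ≤
      (ρ * (p * (1 - p))) ^ (M.e + N.e) * (pairCount n M M * pairCount n N N)
      + ((ρ * (p * (1 - p))) ^ (M.e + N.e) + (p * (1 - p)) ^ (M.e + N.e)) *
        (pairCount n M N * pairCount n M N)
      + 2 ^ (M.e + N.e) * (n : ℝ) ^ (-ε₀ / 2) * (n : ℝ) ^ (M.v + N.v) *
        (p * (1 - p)) ^ (M.e + N.e) *
          ((2 * (M.v + N.v) : ℕ) : ℝ) ^ (2 * (M.v + N.v)) := by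
  have hq : 0 < p * (1 - p) := mul_pos hp0 (by linarith)
  have hn0 : (0 : ℝ) < n := by exact_mod_cast hn
  rw [integral_injCount_mul_mul hp0 hp hρ0 hρ]
  refine (Finset.sum_le_sum fun f₁ _ => Finset.sum_le_sum fun f₂ _ => Finset.sum_le_sum fun g₁ _ =>
    Finset.sum_le_sum fun g₂ _ => edgeMoment_copies_le hn hp0 hp hρ0 hρ hε hM hN f₁ g₁ f₂ g₂).trans ?_
  simp only [Finset.sum_add_distrib, ← Finset.mul_sum, ← Finset.sum_mul]
  have hswap : ∑ f₂ : Fin N.v ↪ Fin n, ∑ g₁ : Fin M.v ↪ Fin n,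
      (if copyEdges M g₁ = copyEdges N f₂ then (1 : ℝ) else 0) = pairCount n M N :=
    Finset.sum_comm
  rw [hswap, add_mul, ← add_assoc]
  have hlast := sum_pow_card_union_four_copyVerts_le (V := Fin n) (r := (n : ℝ)⁻¹) (by positivity)
    (by rw [Fintype.card_fin, mul_inv_cancel₀ hn0.ne']) M N
  have hK : (0 : ℝ) ≤ 2 ^ (M.e + N.e) * (n : ℝ) ^ (-ε₀ / 2) * (n : ℝ) ^ (M.v + N.v) *
        (p * (1 - p)) ^ (M.e + N.e) := by positivity
  exact add_le_add le_rfl (mul_le_mul_of_nonneg_left hlast hK)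

end Moments

/-! ### Second moment of the statistic -/

section SecondMoment

variable {n : ℕ} {p ρ C ε₀ : ℝ}

/-- All bases are at most `4 * C`, and the exponents add up to `a + b + 3 * (c + d) ≤ 8 * C`. -/
lemma two_pow_mul_pow_le (hC : 1 ≤ C) {a b c d : ℕ} (ha : a ≤ C) (hb : b ≤ C) (hc : c ≤ C)
    (hd : d ≤ C) :
    (2 : ℝ) ^ (a + b) * 2 ^ (c + d) * ((2 * (c + d) : ℕ) : ℝ) ^ (2 * (c + d))
      ≤ (4 * C) ^ (8 * C) := by
  have h1 : (1 : ℝ) ≤ 4 * C := by linarith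
  have h2 : (2 : ℝ) ≤ 4 * C := by linarith
  have h3 : ((2 * (c + d) : ℕ) : ℝ) ≤ 4 * C := by push_cast; linarith
  calc _ ≤ (4 * C) ^ (a + b) * (4 * C) ^ (c + d) * (4 * C) ^ (2 * (c + d)) := by gcongr
    _ = (4 * C) ^ ((a + b + (c + d) + 2 * (c + d) : ℕ) : ℝ) := by
        rw [Real.rpow_natCast]; ring
    _ ≤ _ := by
        refine Real.rpow_le_rpow_of_exponent_le h1 ?_
        push_cast
        linarith

lemma pow_le_rpow_mul_pow (hρ0 : 0 < ρ) (hρ : ρ ≤ 1) {a b : ℕ} (ha : a ≤ C) (hb : b ≤ C) :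
    ρ ^ (a + b) ≤ ρ ^ (-2 * C) * (ρ ^ (2 * a) * ρ ^ (2 * b)) := by
  rw [← pow_add, ← Real.rpow_natCast, ← Real.rpow_natCast, ← Real.rpow_add hρ0]
  refine Real.rpow_le_rpow_of_exponent_ge hρ0 hρ ?_
  push_cast
  linarith

lemma weight_mul_weight_mul_integral_le (hn : 0 < n) (hp0 : 0 < p) (hp : p ≤ 1 / 2) (hρ0 : 0 < ρ)
    (hρ : ρ ≤ 1) (hε : 0 < ε₀) (hC : 1 ≤ C) {M N : Motif} (hM : M.IsDense n p ε₀)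
    (hN : N.IsDense n p ε₀) (hMN : Nonempty (M.graph ≃g N.graph) → M = N)
    (hMv : M.v ≤ C) (hMe : M.e ≤ C) (hNv : N.v ≤ C) (hNe : N.e ≤ C)
    (hMn : 2 * M.v ≤ n) (hNn : 2 * N.v ≤ n) [Decidable (M = N)] :
    weight n p ρ M * weight n p ρ N *
      ∫ x, injCount M (fun e => bitVal p (x e).1) * injCount N (fun e => bitVal p (x e).1) *
      (injCount M (fun e => bitVal p (x e).2) * injCount N (fun e => bitVal p (x e).2))
      ∂bitLaw n p ρ ≤
    ρ ^ (2 * M.e) * ρ ^ (2 * N.e) + (if M = N then 2 * ρ ^ (2 * M.e) else 0)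
      + (n : ℝ) ^ (-ε₀ / 2) * (4 * C) ^ (8 * C) * ρ ^ (-2 * C) *
        (ρ ^ (2 * M.e) * ρ ^ (2 * N.e)) := by
  have hq : 0 < p * (1 - p) := mul_pos hp0 (by linarith)
  have hwM : 0 ≤ weight n p ρ M := weight_nonneg hp0 hp hρ0
  have hwN : 0 ≤ weight n p ρ N := weight_nonneg hp0 hp hρ0
  have hself : ∀ L : Motif, L.IsDense n p ε₀ → 2 * L.v ≤ n →
      weight n p ρ L * pairCount n L L * (p * (1 - p)) ^ L.e ≤ ρ ^ L.e := by
    intro L hL hLn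
    rw [← weight_mul_descFactorial_mul_aut (n := n) (ρ := ρ) (M := L) hp0 hp (by omega)]
    have : 0 ≤ weight n p ρ L := weight_nonneg hp0 hp hρ0
    gcongr
    exact pairCount_self_le hL.connected hL.e_ne_zero
  have hself0 : ∀ L : Motif, 0 ≤ weight n p ρ L * pairCount n L L * (p * (1 - p)) ^ L.e :=
    fun L => mul_nonneg (mul_nonneg (weight_nonneg hp0 hp hρ0) pairCount_nonneg) (by positivity)
  have h1 : weight n p ρ M * weight n p ρ N *
      ((ρ * (p * (1 - p))) ^ (M.e + N.e) * (pairCount n M M * pairCount n N N))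
      ≤ ρ ^ (2 * M.e) * ρ ^ (2 * N.e) := by
    calc _ = ρ ^ (M.e + N.e) * ((weight n p ρ M * pairCount n M M * (p * (1 - p)) ^ M.e) *
          (weight n p ρ N * pairCount n N N * (p * (1 - p)) ^ N.e)) := by
          rw [mul_pow ρ, pow_add (p * (1 - p))]; ring
      _ ≤ ρ ^ (M.e + N.e) * (ρ ^ M.e * ρ ^ N.e) :=
          mul_le_mul_of_nonneg_left (mul_le_mul (hself M hM hMn) (hself N hN hNn) (hself0 N)
            (by positivity)) (by positivity)
      _ = _ := by ring
  have h2 : weight n p ρ M * weight n p ρ N *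
      (((ρ * (p * (1 - p))) ^ (M.e + N.e) + (p * (1 - p)) ^ (M.e + N.e)) *
        (pairCount n M N * pairCount n M N)) ≤ if M = N then 2 * ρ ^ (2 * M.e) else 0 := by
    split_ifs with h
    · subst h
      -- The matching across the two graphs brings an extra `ρ ^ (2 * M.e)`, the matching within
      -- each graph brings `1`; the constant 2 is the bound for their sum.
      have hρe : ρ ^ (2 * M.e) ≤ 1 := pow_le_one₀ hρ0.le hρ
      calc _ = (ρ ^ (2 * M.e) + 1) * ((weight n p ρ M * pairCount n M M * (p * (1 - p)) ^ M.e) *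
            (weight n p ρ M * pairCount n M M * (p * (1 - p)) ^ M.e)) := by
            rw [mul_pow ρ, pow_add (p * (1 - p)), two_mul]; ring
        _ ≤ (1 + 1) * (ρ ^ M.e * ρ ^ M.e) :=
            mul_le_mul (by linarith) (mul_le_mul (hself M hM hMn) (hself M hM hMn) (hself0 M)
              (by positivity)) (mul_nonneg (hself0 M) (hself0 M)) (by norm_num)
        _ = _ := by ring
    · rw [pairCount_eq_zero hM.connected hM.e_ne_zero hN.connected hN.e_ne_zero
        fun h' => h (hMN h')]
      simp
  have h3 : weight n p ρ M * weight n p ρ N *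
      (2 ^ (M.e + N.e) * (n : ℝ) ^ (-ε₀ / 2) * (n : ℝ) ^ (M.v + N.v) *
        (p * (1 - p)) ^ (M.e + N.e) * ((2 * (M.v + N.v) : ℕ) : ℝ) ^ (2 * (M.v + N.v)))
      ≤ (n : ℝ) ^ (-ε₀ / 2) * (4 * C) ^ (8 * C) * ρ ^ (-2 * C) *
        (ρ ^ (2 * M.e) * ρ ^ (2 * N.e)) := by
    set D : ℝ := ((2 * (M.v + N.v) : ℕ) : ℝ) ^ (2 * (M.v + N.v)) with hD
    have hD0 : 0 ≤ D := by positivity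
    calc _ = (n : ℝ) ^ (-ε₀ / 2) * (2 ^ (M.e + N.e) * D) *
          ((weight n p ρ M * (n : ℝ) ^ M.v * (p * (1 - p)) ^ M.e) *
          (weight n p ρ N * (n : ℝ) ^ N.v * (p * (1 - p)) ^ N.e)) := by
          rw [pow_add (p * (1 - p)), pow_add (n : ℝ)]; ring
      _ ≤ (n : ℝ) ^ (-ε₀ / 2) * (2 ^ (M.e + N.e) * D) *
          ((2 ^ M.v * ρ ^ M.e) * (2 ^ N.v * ρ ^ N.e)) :=
          mul_le_mul_of_nonneg_left (mul_le_mul (weight_mul_pow_le hp0 hp hρ0 hMn)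
            (weight_mul_pow_le hp0 hp hρ0 hNn) (by positivity) (by positivity)) (by positivity)
      _ = (n : ℝ) ^ (-ε₀ / 2) * (2 ^ (M.e + N.e) * 2 ^ (M.v + N.v) * D) * ρ ^ (M.e + N.e) := by
          ring
      _ ≤ (n : ℝ) ^ (-ε₀ / 2) * (4 * C) ^ (8 * C) *
          (ρ ^ (-2 * C) * (ρ ^ (2 * M.e) * ρ ^ (2 * N.e))) := by
          gcongr
          · exact two_pow_mul_pow_le hC hMe hNe hMv hNv
          · exact pow_le_rpow_mul_pow hρ0 hρ hMe hNe
      _ = _ := by ring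
  refine (mul_le_mul_of_nonneg_left (integral_injCount_mul_mul_le hn hp0 hp hρ0 hρ hε hM hN)
    (mul_nonneg hwM hwN)).trans ?_
  rw [mul_add, mul_add]
  exact add_le_add (add_le_add h1 h2) h3

lemma integral_bitStatistic_sq_le (hn : 0 < n) (hp0 : 0 < p) (hp : p ≤ 1 / 2) (hρ0 : 0 < ρ)
    (hρ : ρ ≤ 1) (hε : 0 < ε₀) (hC : 1 ≤ C) (hCn : 2 * C ≤ n) {𝓕 : Finset Motif}
    (hfam : IsMotifFamily 𝓕) (hdense : ∀ M ∈ 𝓕, M.IsDense n p ε₀)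
    (hsize : ∀ M ∈ 𝓕, max (M.v : ℝ) (M.e : ℝ) ≤ C) :
    ∫ x, bitStatistic n p ρ 𝓕 x ^ 2 ∂bitLaw n p ρ ≤ signalScore ρ 𝓕 ^ 2 + 2 * signalScore ρ 𝓕
      + (n : ℝ) ^ (-ε₀ / 2) * (4 * C) ^ (8 * C) * ρ ^ (-2 * C) * signalScore ρ 𝓕 ^ 2 := by
  classical
  have := isProbabilityMeasure_corrBernoulli hp0 hp hρ0 hρ
  have : IsProbabilityMeasure (bitLaw n p ρ) := by unfold bitLaw; infer_instance
  have hexpand : ∀ x, bitStatistic n p ρ 𝓕 x ^ 2 = ∑ M ∈ 𝓕, ∑ N ∈ 𝓕,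
      weight n p ρ M * weight n p ρ N *
      (injCount M (fun e => bitVal p (x e).1) * injCount N (fun e => bitVal p (x e).1) *
      (injCount M (fun e => bitVal p (x e).2) * injCount N (fun e => bitVal p (x e).2))) := by
    intro x
    rw [bitStatistic, sq, Finset.sum_mul_sum]
    exact Finset.sum_congr rfl fun M _ => Finset.sum_congr rfl fun N _ => by ring
  have h2v : ∀ M ∈ 𝓕, 2 * M.v ≤ n := fun M hM => by
    have h := (le_max_left _ _).trans (hsize M hM)
    have : (2 * M.v : ℝ) ≤ n := by linarith
    exact_mod_cast this
  have hint : ∫ x, bitStatistic n p ρ 𝓕 x ^ 2 ∂bitLaw n p ρ = ∑ M ∈ 𝓕, ∑ N ∈ 𝓕,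
      weight n p ρ M * weight n p ρ N *
      ∫ x, injCount M (fun e => bitVal p (x e).1) * injCount N (fun e => bitVal p (x e).1) *
      (injCount M (fun e => bitVal p (x e).2) * injCount N (fun e => bitVal p (x e).2))
      ∂bitLaw n p ρ := by
    simp only [hexpand]
    rw [integral_finsetSum _ fun _ _ => Integrable.of_finite]
    refine Finset.sum_congr rfl fun M _ => ?_
    rw [integral_finsetSum _ fun _ _ => Integrable.of_finite]
    exact Finset.sum_congr rfl fun N _ => integral_const_mul _ _
  rw [hint]
  refine (Finset.sum_le_sum fun M hM => Finset.sum_le_sum fun N hN =>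
    weight_mul_weight_mul_integral_le hn hp0 hp hρ0 hρ hε hC (hdense M hM) (hdense N hN)
      (hfam M hM N hN) ((le_max_left _ _).trans (hsize M hM))
      ((le_max_right _ _).trans (hsize M hM)) ((le_max_left _ _).trans (hsize N hN))
      ((le_max_right _ _).trans (hsize N hN)) (h2v M hM) (h2v N hN)).trans (le_of_eq ?_)
  have hdiag : ∑ M ∈ 𝓕, ∑ N ∈ 𝓕, (if M = N then 2 * ρ ^ (2 * M.e) else 0)
      = 2 * signalScore ρ 𝓕 := by
    rw [signalScore, Finset.mul_sum]
    exact Finset.sum_congr rfl fun M hM => by rw [Finset.sum_ite_eq, if_pos hM]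
  simp only [Finset.sum_add_distrib, hdiag]
  simp only [← Finset.mul_sum, ← Finset.sum_mul, signalScore, sq]

end SecondMoment

/-! ### Variance bound and the range of `C` -/

/-- The pairing argument needs copies without isolated vertices, so edgeless motifs must be set
aside. Their counts are deterministic, and a constant does not affect the variance. -/
lemma exists_bitStatistic_eq_filter_add (n : ℕ) (p ρ : ℝ) (𝓜 : Finset Motif) :
    ∃ c, ∀ x, bitStatistic n p ρ 𝓜 x
      = bitStatistic n p ρ (𝓜.filter fun M => M.e ≠ 0) x + c := by
  refine ⟨∑ M ∈ 𝓜 with ¬ M.e ≠ 0, weight n p ρ M * (Fintype.card (Fin M.v ↪ Fin n) : ℝ) *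
    (Fintype.card (Fin M.v ↪ Fin n) : ℝ), fun x => ?_⟩
  have hconst : ∀ M : Motif, M.e = 0 → ∀ β : Sym2 (Fin n) → ℝ,
      injCount M β = Fintype.card (Fin M.v ↪ Fin n) := by
    intro M hM β
    have : ∀ f : Fin M.v ↪ Fin n, homWeight M β f = 1 := fun f => by
      have hE : copyEdges M f = ∅ := by rw [← Finset.card_eq_zero, card_copyEdges, hM]
      rw [homWeight_eq_prod_copyEdges, hE, Finset.prod_empty]
    simp only [injCount, this, Finset.sum_const, Finset.card_univ, nsmul_eq_mul, mul_one]
  rw [bitStatistic, ← Finset.sum_filter_add_sum_filter_not 𝓜 fun M => M.e ≠ 0, bitStatistic]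
  congr 1
  refine Finset.sum_congr rfl fun M hM => ?_
  have hM0 : M.e = 0 := not_not.1 (Finset.mem_filter.1 hM).2
  rw [hconst M hM0, hconst M hM0]

lemma IsAdmissible.one_le {n : ℕ} {p ρ C ε₀ : ℝ} {𝓜 : Finset Motif}
    (hadm : IsAdmissible n p ρ C ε₀ 𝓜) : 1 ≤ C ∧ (n : ℝ) ^ ε₀ ≤ n := by
  have hne : 𝓜.Nonempty := by
    rw [Finset.nonempty_iff_ne_empty]
    rintro rfl
    have := hadm.signal
    simp only [signalScore, Finset.sum_empty] at this
    linarith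
  obtain ⟨M, hM⟩ := hne
  obtain ⟨a⟩ := (hadm.connected M hM).nonempty
  constructor
  · have h := (le_max_left _ _).trans (hadm.size_le M hM)
    have : (1 : ℝ) ≤ M.v := by exact_mod_cast (by have := a.isLt; omega : 1 ≤ M.v)
    linarith
  -- A single vertex is a subgraph with no edges.
  · have h := hadm.subgraph M hM (M.graph.singletonSubgraph a) (by simp)
    simpa using h

lemma variance_bitStatistic_le {n : ℕ} {p ρ C ε₀ : ℝ} (hn : 0 < n) (hp0 : 0 < p)
    (hp : p ≤ 1 / 2) (hρ0 : 0 < ρ) (hρ : ρ ≤ 1) (hCn : 2 * C ≤ n) {𝓜 : Finset Motif}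
    (hfam : IsMotifFamily 𝓜) (hadm : IsAdmissible n p ρ C ε₀ 𝓜) :
    variance (bitStatistic n p ρ 𝓜) (bitLaw n p ρ) ≤ 2 * signalScore ρ 𝓜
      + (n : ℝ) ^ (-ε₀ / 2) * (4 * C) ^ (8 * C) * ρ ^ (-2 * C) * signalScore ρ 𝓜 ^ 2 := by
  have := isProbabilityMeasure_corrBernoulli hp0 hp hρ0 hρ
  have : IsProbabilityMeasure (bitLaw n p ρ) := by unfold bitLaw; infer_instance
  have hC := hadm.one_le.1
  set 𝓕 := 𝓜.filter fun M => M.e ≠ 0 with h𝓕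
  have hsub : 𝓕 ⊆ 𝓜 := Finset.filter_subset _ _
  obtain ⟨c, hc⟩ := exists_bitStatistic_eq_filter_add n p ρ 𝓜
  have hvar : variance (bitStatistic n p ρ 𝓜) (bitLaw n p ρ)
      = variance (bitStatistic n p ρ 𝓕) (bitLaw n p ρ) := by
    rw [funext hc]
    exact variance_add_const (measurable_of_countable _).aestronglyMeasurable c
  have hvn : ∀ M ∈ 𝓕, M.v ≤ n := fun M hM => by
    have h := (le_max_left _ _).trans (hadm.size_le M (hsub hM))
    have : (M.v : ℝ) ≤ n := by linarith
    exact_mod_cast this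
  have hmean := signalScore_le_integral_bitStatistic hp0 hp hρ0 hρ 𝓕 hvn
  have hsq := integral_bitStatistic_sq_le hn hp0 hp hρ0 hρ hadm.eps_pos hC hCn (𝓕 := 𝓕)
    (fun M hM N hN => hfam M (hsub hM) N (hsub hN))
    (fun M hM => ⟨hadm.connected M (hsub hM), (Finset.mem_filter.1 hM).2,
      hadm.subgraph M (hsub hM)⟩)
    fun M hM => hadm.size_le M (hsub hM)
  have hS0 : 0 ≤ signalScore ρ 𝓕 := Finset.sum_nonneg fun M _ => by positivity
  have hS : signalScore ρ 𝓕 ≤ signalScore ρ 𝓜 :=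
    Finset.sum_le_sum_of_subset_of_nonneg hsub fun M _ _ => by positivity
  -- The squared mean cancels the leading term of the second moment.
  have hmean2 : signalScore ρ 𝓕 ^ 2 ≤ (∫ x, bitStatistic n p ρ 𝓕 x ∂bitLaw n p ρ) ^ 2 := by
    gcongr
  have hL : (n : ℝ) ^ (-ε₀ / 2) * (4 * C) ^ (8 * C) * ρ ^ (-2 * C) * signalScore ρ 𝓕 ^ 2
      ≤ (n : ℝ) ^ (-ε₀ / 2) * (4 * C) ^ (8 * C) * ρ ^ (-2 * C) * signalScore ρ 𝓜 ^ 2 := by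
    gcongr
  rw [hvar, variance_eq_sub (MemLp.of_discrete)]
  simp only [Pi.pow_apply]
  linarith

/-- The factor `(4 * C) ^ (8 * C)` is at least `4 * C`, and `n ^ (ε₀ / 2) ≤ n`. A small error term
therefore forces `12 * C < 5 / 4 * n`. -/
lemma four_mul_le_of_lt {n : ℕ} {ρ C ε₀ : ℝ} (hn : 0 < n) (hρ0 : 0 < ρ) (hρ : ρ ≤ 1)
    (hε : 0 < ε₀) (hC : 1 ≤ C) (hnε : (n : ℝ) ^ ε₀ ≤ n)
    (h : 3 * (n : ℝ) ^ (-ε₀ / 2) * (4 * C) ^ (8 * C) * ρ ^ (-2 * C) < 5 / 4) :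
    4 * C ≤ n := by
  have hn1 : (1 : ℝ) ≤ n := by exact_mod_cast hn
  have hn0 : (0 : ℝ) < n := by linarith
  have h1 : 1 ≤ ρ ^ (-2 * C) := Real.one_le_rpow_of_pos_of_le_one_of_nonpos hρ0 hρ (by linarith)
  have h2 : 4 * C ≤ (4 * C) ^ (8 * C) :=
    Real.self_le_rpow_of_one_le (by linarith) (by linarith)
  have h3 : (n : ℝ) ^ (ε₀ / 2) ≤ n :=
    (Real.rpow_le_rpow_of_exponent_le hn1 (by linarith)).trans hnε
  have hpos : 0 < (n : ℝ) ^ (ε₀ / 2) := Real.rpow_pos_of_pos hn0 _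
  rw [neg_div, Real.rpow_neg hn0.le] at h
  have h4 : 3 * ((n : ℝ) ^ (ε₀ / 2))⁻¹ * (4 * C) ≤
      3 * ((n : ℝ) ^ (ε₀ / 2))⁻¹ * (4 * C) ^ (8 * C) * ρ ^ (-2 * C) :=
    (mul_le_mul_of_nonneg_left h2 (by positivity)).trans
      (le_mul_of_one_le_right (by positivity) h1)
  have h5 : 3 * ((n : ℝ) ^ (ε₀ / 2))⁻¹ * (4 * C) < 5 / 4 := h4.trans_lt h
  have h6 : 3 * (4 * C) < 5 / 4 * (n : ℝ) ^ (ε₀ / 2) := by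
    have := mul_lt_mul_of_pos_right h5 hpos
    field_simp at this
    linarith
  linarith

end MotifCount

open MeasureTheory ProbabilityTheory in
theorem mainTheorem2 (n : ℕ) (hn : 0 < n) (p ρ C ε₀ : ℝ)
    (hp0 : 0 < p) (hp : p ≤ 1 / 2) (hρ0 : 0 < ρ) (hρ : ρ ≤ 1)
    (𝓜 : Finset MotifCount.Motif) (hfam : MotifCount.IsMotifFamily 𝓜)
    (hadm : MotifCount.IsAdmissible n p ρ C ε₀ 𝓜)
    (τ : ℝ) (hτ : τ = (1 / 2) * ∫ G, MotifCount.statistic n p ρ 𝓜 G ∂MotifCount.corrER n p ρ) :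
    (MotifCount.corrER n p ρ).real {G | MotifCount.statistic n p ρ 𝓜 G < τ} ≤
      4 * (3 * (n : ℝ) ^ (-ε₀ / 2) * (4 * C) ^ (8 * C) * ρ ^ (-2 * C)
        + (Real.exp (C ^ 2 / ((n : ℝ) - 2 * C + 1)) + 1) / MotifCount.signalScore ρ 𝓜
        + Real.exp (C ^ 2 / ((n : ℝ) - 2 * C + 1)) - 1) := by
  have := MotifCount.isProbabilityMeasure_corrBernoulli hp0 hp hρ0 hρ
  have : IsProbabilityMeasure (MotifCount.bitLaw n p ρ) := by
    unfold MotifCount.bitLaw; infer_instance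
  obtain ⟨hC, hnε⟩ := hadm.one_le
  have hsig := hadm.signal
  rw [MotifCount.corrER_real_statistic_lt]
  rw [MotifCount.integral_statistic_corrER] at hτ
  set S := MotifCount.signalScore ρ 𝓜
  set μ := MotifCount.bitLaw n p ρ
  set T := MotifCount.bitStatistic n p ρ 𝓜 with hT
  set κ := Real.exp (C ^ 2 / ((n : ℝ) - 2 * C + 1)) with hκ
  have hS0 : 0 < S := by linarith
  have hκ0 : 0 < κ := Real.exp_pos _
  -- With `5 / 4` the claimed bound is at least `4 * (5 / 4 - 1) = 1` using only `κ > 0`, whatever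
  -- the sign of `n - 2 * C + 1`.
  by_cases hbig : 5 / 4 ≤ 3 * (n : ℝ) ^ (-ε₀ / 2) * (4 * C) ^ (8 * C) * ρ ^ (-2 * C)
  · have hprob : μ.real {x | T x < τ} ≤ 1 := measureReal_le_one
    have : 0 ≤ (κ + 1) / S := by positivity
    linarith
  have hCn : 4 * C ≤ n :=
    MotifCount.four_mul_le_of_lt hn hρ0 hρ hadm.eps_pos hC hnε (not_le.1 hbig)
  have hκ1 : 1 ≤ κ := Real.one_le_exp (div_nonneg (sq_nonneg C) (by linarith))
  have hvar := MotifCount.variance_bitStatistic_le hn hp0 hp hρ0 hρ (by linarith) hfam hadm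
  set L := (n : ℝ) ^ (-ε₀ / 2) * (4 * C) ^ (8 * C) * ρ ^ (-2 * C) with hL
  have hL0 : 0 ≤ L := by positivity
  have hmean : S ≤ ∫ x, T x ∂μ := by
    refine MotifCount.signalScore_le_integral_bitStatistic hp0 hp hρ0 hρ 𝓜 fun M hM => ?_
    have h := (le_max_left _ _).trans (hadm.size_le M hM)
    have : (M.v : ℝ) ≤ n := by linarith
    exact_mod_cast this
  have hτS : S / 2 ≤ τ := by linarith
  have hτ0 : 0 < τ := by linarith
  have hcheb := meas_ge_le_variance_div_sq (μ := μ) (X := T) MemLp.of_discrete hτ0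
  -- As `τ` is half the mean, falling below `τ` is a deviation of at least `τ`.
  have hsubset : {x | T x < τ} ⊆ {x | τ ≤ |T x - ∫ y, T y ∂μ|} := by
    intro x hx
    have hx' : T x < τ := hx
    have : τ ≤ |T x - ∫ y, T y ∂μ| := by
      rw [abs_sub_comm]
      exact le_trans (by linarith) (le_abs_self _)
    exact this
  have hle : μ.real {x | T x < τ} ≤ variance T μ / τ ^ 2 :=
    ENNReal.toReal_le_of_le_ofReal (div_nonneg (variance_nonneg _ _) (sq_nonneg _))
      ((measure_mono hsubset).trans hcheb)
  calc μ.real {x | T x < τ} ≤ variance T μ / τ ^ 2 := hle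
    _ ≤ (2 * S + L * S ^ 2) / (S / 2) ^ 2 := by
        gcongr
    _ = 4 * (L + 2 / S) := by
        field_simp
        ring
    -- Only `κ ≥ 1` is needed: the weights cancel the falling factorials exactly, so `κ` does not
    -- arise in the variance bound.
    _ ≤ 4 * (3 * L + (κ + 1) / S + (κ - 1)) := by
        have : 2 / S ≤ (κ + 1) / S := by
          gcongr
          linarith
        linarith
    _ = _ := by rw [hL]; ring
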